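/- Let $\hat{\mathcal L}_0$ be the class of equations $$u_t+uu_x=A^2(t,x)u_{xx}+\bigl(A^{11}(t)x+A^{10}(t)\bigr)u_x,$$ where the tuple of arbitrary elements $\theta=(A^{10},A^{11},A^2)$ consists of smooth real functions of the indicated arguments and $A^2\neq0$ everywhere. A point transformation is a smooth diffeomorphism $\varphi\colon(t,x,u)\mapsto(\tilde t,\tilde x,\tilde u)$ between open subsets $\Omega$ and $\tilde\Omega$ of $\mathbb R^3$, where the sections of $\Omega$ by the planes $t=\mathrm{const}$ are connected. The equivalence groupoid $\hat{\mathcal G}^\sim_0$ of the class is the set of triples $(\theta,\varphi,\tilde\theta)$, where $\theta$ and $\tilde\theta$ are tuples of arbitrary elements of equations from the class over the projections of $\Omega$ and $\tilde\Omega$, respectively, and $\varphi$ is a point transformation that maps the equation with $\theta$ to the equation with $\tilde\theta$: whenever the second prolongation of $\varphi$ maps a second-order jet $z$ over $\Omega$ to a jet $\tilde z$, $z$ satisfies the former equation if and only if $\tilde z$ satisfies the latter. Proposition. The groupoid $\hat{\mathcal G}^\sim_0$ consists of exactly those triples $(\theta,\varphi,\tilde\theta)$, with $\theta$ and $\tilde\theta$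 tuples of arbitrary elements of the class over the projections of $\Omega$ and $\tilde\Omega$, for which there are smooth functions $T$, $X^0$, $U^1$ and $U^{00}$ of $t$ (on the projection of $\Omega$ to the $t$-axis) with $T_tU^1\neq0$ such that the components of $\varphi$ are $$\tilde t=T,\quad \tilde x=T_tU^1x+X^0,\quad \tilde u=U^1u-U^1_tx+U^{00},$$ the equations $$U^1_{tt}=A^{11}U^1_t,\quad U^{00}_t=-A^{10}U^1_t$$ hold, and $$\tilde A^2=(U^1)^2T_tA^2,\quad \tilde A^{11}=\frac1{T_t}\Bigl(A^{11}-\frac{T_{tt}}{T_t}-\frac{2U^1_t}{U^1}\Bigr),$$ $$\tilde A^{10}=U^1A^{10}-\frac{X^0_t}{T_t}+U^{00}-\frac{X^0}{T_t}\Bigl(A^{11}-\frac{T_{tt}}{T_t}-\frac{2U^1_t}{U^1}\Bigr),$$ where the left- and right-hand sides of the last three relations are evaluated at the new variables $(\tilde t,\tilde x)$ and at the old variables $(t,x)$, respectively. -/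

import Mathlib

open scoped ContDiff

namespace BurgersL0

/-- A point of the second-order jet space `J²` over the space with coordinates `(t, x, u)`,
`t` and `x` being the independent variables and `u` the dependent variable. -/
structure Jet where
  t : ℝ
  x : ℝ
  u : ℝ
  ut : ℝ
  ux : ℝ
  utt : ℝ
  utx : ℝ
  uxx : ℝ

/-- The projection `J² → ℝ³` to the space with coordinates `(t, x, u)`. -/
def Jet.pt (z : Jet) : ℝ × ℝ × ℝ := (z.t, z.x, z.u)

/-- The vector `∂_t + u_t ∂_u`. -/
def Jet.vt (z : Jet) : ℝ × ℝ × ℝ := (1, 0, z.ut)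

/-- The vector `∂_x + u_x ∂_u`. -/
def Jet.vx (z : Jet) : ℝ × ℝ × ℝ := (0, 1, z.ux)

section TotalDerivatives

variable (F : ℝ × ℝ × ℝ → ℝ) (z : Jet)

/-- The total derivative `D_t F = F_t + u_t F_u` of a function `F` of `(t, x, u)`. -/
noncomputable def Dt : ℝ := fderiv ℝ F z.pt z.vt

/-- The total derivative `D_x F = F_x + u_x F_u`. -/
noncomputable def Dx : ℝ := fderiv ℝ F z.pt z.vx

/-- The second total derivative
`D_t D_t F = F_tt + 2 u_t F_tu + u_t² F_uu + u_tt F_u`. -/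
noncomputable def Dtt : ℝ :=
  fderiv ℝ (fderiv ℝ F) z.pt z.vt z.vt + z.utt * fderiv ℝ F z.pt (0, 0, 1)

/-- The second total derivative
`D_t D_x F = F_tx + u_x F_tu + u_t F_xu + u_t u_x F_uu + u_tx F_u`. -/
noncomputable def Dtx : ℝ :=
  fderiv ℝ (fderiv ℝ F) z.pt z.vt z.vx + z.utx * fderiv ℝ F z.pt (0, 0, 1)

/-- The second total derivative
`D_x D_x F = F_xx + 2 u_x F_xu + u_x² F_uu + u_xx F_u`. -/
noncomputable def Dxx : ℝ :=
  fderiv ℝ (fderiv ℝ F) z.pt z.vx z.vx + z.uxx * fderiv ℝ F z.pt (0, 0, 1)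

end TotalDerivatives

/-- A (local) point transformation in the space with coordinates `(t, x, u)`: a smooth
diffeomorphism between two open subsets of `ℝ³`. The sections of the domain by the planes
`t = const` are assumed to be connected (possibly empty); otherwise a function on the domain
all of whose derivatives with respect to `x` and `u` vanish need not be a function of `t`. -/
structure PointTransformation where
  /-- the underlying homeomorphism between open subsets -/
  toHomeo : OpenPartialHomeomorph (ℝ × ℝ × ℝ) (ℝ × ℝ × ℝ)
  smooth : ContDiffOn ℝ ∞ toHomeo toHomeo.source
  smooth_symm : ContDiffOn ℝ ∞ toHomeo.symm toHomeo.target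
  section_connected :
    ∀ t : ℝ, IsPreconnected {q : ℝ × ℝ | (t, q.1, q.2) ∈ toHomeo.source}

namespace PointTransformation

variable (φ : PointTransformation)

/-- The domain, an open set of the space with coordinates `(t, x, u)`. -/
def dom : Set (ℝ × ℝ × ℝ) := φ.toHomeo.source

/-- The image of the domain. -/
def ran : Set (ℝ × ℝ × ℝ) := φ.toHomeo.target

/-- The component `t̃` as a function of `(t, x, u)`. -/
def tComp (p : ℝ × ℝ × ℝ) : ℝ := (φ.toHomeo p).1

/-- The component `x̃` as a function of `(t, x, u)`. -/
def xComp (p : ℝ × ℝ × ℝ) : ℝ := (φ.toHomeo p).2.1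

/-- The component `ũ` as a function of `(t, x, u)`. -/
def uComp (p : ℝ × ℝ × ℝ) : ℝ := (φ.toHomeo p).2.2

/-- `φ.Prolongs z w`: the second prolongation of the point transformation `φ` maps the jet `z`
to the jet `w`. The conditions are those obtained for the 2-jets of functions `f` and `g`, the
graph of the former being mapped by `φ` to the graph of the latter, by differentiating the identity
`ũ(t, x, f) = g(t̃(t, x, f), x̃(t, x, f))` up to two times with respect to `t` and `x`.
The jet `w` exists if and only if
`D_t t̃ * D_x x̃ - D_x t̃ * D_t x̃ ≠ 0` at `z`, and then it is unique. -/
structure Prolongs (z w : Jet) : Prop where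
  mem : z.pt ∈ φ.dom
  pt : w.pt = (φ.tComp z.pt, φ.xComp z.pt, φ.uComp z.pt)
  dt : Dt φ.uComp z = w.ut * Dt φ.tComp z + w.ux * Dt φ.xComp z
  dx : Dx φ.uComp z = w.ut * Dx φ.tComp z + w.ux * Dx φ.xComp z
  dtt : Dtt φ.uComp z = w.ut * Dtt φ.tComp z + w.ux * Dtt φ.xComp z
    + w.utt * Dt φ.tComp z ^ 2 + 2 * w.utx * Dt φ.tComp z * Dt φ.xComp z
    + w.uxx * Dt φ.xComp z ^ 2
  dtx : Dtx φ.uComp z = w.ut * Dtx φ.tComp z + w.ux * Dtx φ.xComp z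
    + w.utt * Dt φ.tComp z * Dx φ.tComp z
    + w.utx * (Dt φ.tComp z * Dx φ.xComp z + Dx φ.tComp z * Dt φ.xComp z)
    + w.uxx * Dt φ.xComp z * Dx φ.xComp z
  dxx : Dxx φ.uComp z = w.ut * Dxx φ.tComp z + w.ux * Dxx φ.xComp z
    + w.utt * Dx φ.tComp z ^ 2 + 2 * w.utx * Dx φ.tComp z * Dx φ.xComp z
    + w.uxx * Dx φ.xComp z ^ 2

end PointTransformation

/-- The projection of a set of points `(t, x, u)` to the `t`-axis. -/
def projT (S : Set (ℝ × ℝ × ℝ)) : Set ℝ := (fun p => p.1) '' S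

/-- The projection of a set of points `(t, x, u)` to the `(t, x)`-plane. -/
def projTX (S : Set (ℝ × ℝ × ℝ)) : Set (ℝ × ℝ) := (fun p => (p.1, p.2.1)) '' S

/-- A tuple `(A¹⁰, A¹¹, A²)` of arbitrary elements; `A¹⁰` and `A¹¹` depend on `t` only.
Values outside the domain under consideration are irrelevant. -/
structure ArbitraryElements where
  A10 : ℝ → ℝ
  A11 : ℝ → ℝ
  A2 : ℝ × ℝ → ℝ

namespace ArbitraryElements

variable (θ : ArbitraryElements)

/-- Over the open set `S` of points `(t, x, u)`, the tuple `θ` satisfies the auxiliary system of the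
class: it consists of smooth functions, and `A²` vanishes nowhere. -/
structure InClass (S : Set (ℝ × ℝ × ℝ)) : Prop where
  smooth10 : ContDiffOn ℝ ∞ θ.A10 (projT S)
  smooth11 : ContDiffOn ℝ ∞ θ.A11 (projT S)
  smooth2 : ContDiffOn ℝ ∞ θ.A2 (projTX S)
  ne_zero : ∀ q ∈ projTX S, θ.A2 q ≠ 0

/-- The equation `u_t + u u_x = A²(t,x) u_xx + (A¹¹(t) x + A¹⁰(t)) u_x`
as a subset of the jet space. -/
def equation : Set Jet :=
  {z | z.ut + z.u * z.ux = θ.A2 (z.t, z.x) * z.uxx + (θ.A11 z.t * z.x + θ.A10 z.t) * z.ux}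

end ArbitraryElements

/-- The equivalence groupoid of the class: the set of admissible transformations, i.e., of triples
`(θ, φ, θ')` such that `θ` and `θ'` belong to the class (over the domain and over the image of `φ`,
respectively) and the point transformation `φ` maps the equation with the arbitrary elements `θ`
to the equation with the arbitrary elements `θ'`. -/
def equivalenceGroupoid : Set (ArbitraryElements × PointTransformation × ArbitraryElements) :=
  {a | a.1.InClass a.2.1.dom ∧ a.2.2.InClass a.2.1.ran ∧
    ∀ z w : Jet, a.2.1.Prolongs z w → (z ∈ a.1.equation ↔ w ∈ a.2.2.equation)}

end BurgersL0

/-! Write T, X, U for the components of φ and Δ = D_t T D_x X - D_x T D_t X. Necessity rests on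
splitting the condition that jets on the source equation go to jets on the target equation.

The source equation does not involve u_tt. Varying u_tt alone keeps the first-order part of the
image jet, and then the target equation keeps ũ_xx, since Ã² ≠ 0. The chain rule, however, makes Δ²
ũ_xx depend on u_tt with coefficient (D_x T)² (U_u - ũ_t T_u - ũ_x X_u). The last factor times Δ is
the Jacobian, so D_x T = 0 (`Dx_tComp_eq_zero`), whence T_x = T_u = 0 (`pd_tComp_eq_zero`). The jets
on the equation are now parametrized by u_x and u_xx. The coefficient of u_xx gives (D_x X)² A² =
T_t Ã² for all admissible u_x, so X_u = 0 (`xComp_conditions`); what remains is quadratic in u_x and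
yields three equations (`determining_equations`). Differentiating them in u gives X_x = T_t U_u,
U_xu = 0 and U_x = -U_tu (`solved_determining_equations`). Connected sections turn functions of
vanishing x- and u-derivative into functions of t, which gives the form of φ (`exists_hasForm`);
splitting in x gives the remaining relations (`relations_of_hasForm`).

Sufficiency is one identity: T_t times the defect of the target equation equals U¹ times the defect
of the source equation (`mem_equation_iff`). -/

namespace BurgersL0

/-- The directional derivative of `F` along the constant vector field `v`. -/
noncomputable def pd (v : ℝ × ℝ × ℝ) (F : ℝ × ℝ × ℝ → ℝ) (p : ℝ × ℝ × ℝ) : ℝ := fderiv ℝ F p v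

/-- The coordinate vector `∂_t`. -/
def et : ℝ × ℝ × ℝ := (1, 0, 0)

/-- The coordinate vector `∂_x`. -/
def ex : ℝ × ℝ × ℝ := (0, 1, 0)

/-- The coordinate vector `∂_u`. -/
def eu : ℝ × ℝ × ℝ := (0, 0, 1)

/-! ### Calculus of coordinate derivatives on open sets -/

section PartialDerivatives

variable {S : Set (ℝ × ℝ × ℝ)} {F G : ℝ × ℝ × ℝ → ℝ}

theorem contDiffOn_pd (hS : IsOpen S) (hF : ContDiffOn ℝ ∞ F S) (v : ℝ × ℝ × ℝ) :
    ContDiffOn ℝ ∞ (pd v F) S :=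
  (hF.fderiv_of_isOpen hS (by simp)).clm_apply contDiffOn_const

theorem differentiableAt_of_smooth (hS : IsOpen S) (hF : ContDiffOn ℝ ∞ F S) {p : ℝ × ℝ × ℝ}
    (hp : p ∈ S) : DifferentiableAt ℝ F p :=
  (hF.contDiffAt (hS.mem_nhds hp)).differentiableAt (by simp)

theorem fderiv_fderiv_apply (hS : IsOpen S) (hF : ContDiffOn ℝ ∞ F S) {p : ℝ × ℝ × ℝ}
    (hp : p ∈ S) (v w : ℝ × ℝ × ℝ) : fderiv ℝ (fderiv ℝ F) p v w = pd v (pd w F) p := by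
  have h : DifferentiableAt ℝ (fderiv ℝ F) p :=
    ((hF.fderiv_of_isOpen (m := ∞) hS (by simp)).contDiffAt (hS.mem_nhds hp)).differentiableAt
      (by simp)
  have := (h.hasFDerivAt.clm_apply (hasFDerivAt_const w p)).fderiv
  unfold pd
  rw [this]
  simp

theorem pd_comm (hS : IsOpen S) (hF : ContDiffOn ℝ ∞ F S) {p : ℝ × ℝ × ℝ}
    (hp : p ∈ S) (v w : ℝ × ℝ × ℝ) : pd v (pd w F) p = pd w (pd v F) p := by
  rw [← fderiv_fderiv_apply hS hF hp, ← fderiv_fderiv_apply hS hF hp]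
  exact ((hF.contDiffAt (hS.mem_nhds hp)).isSymmSndFDerivAt (by simp; exact WithTop.coe_le_coe.2 (le_top : (2 : ℕ∞) ≤ ⊤))).eq v w

theorem pd_congr (hS : IsOpen S) (h : ∀ p ∈ S, F p = G p) {p : ℝ × ℝ × ℝ} (hp : p ∈ S)
    (v : ℝ × ℝ × ℝ) : pd v F p = pd v G p := by
  unfold pd
  rw [Filter.EventuallyEq.fderiv_eq (Filter.eventually_of_mem (hS.mem_nhds hp) h)]

theorem pd_eq_zero_of_eq_zero (hS : IsOpen S) (h : ∀ p ∈ S, F p = 0) {p : ℝ × ℝ × ℝ} (hp : p ∈ S)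
    (v : ℝ × ℝ × ℝ) : pd v F p = 0 := by
  rw [pd_congr (G := fun _ => 0) hS h hp]
  simp [pd]

theorem fderiv_apply_eq (F : ℝ × ℝ × ℝ → ℝ) (p : ℝ × ℝ × ℝ) (a b c : ℝ) :
    fderiv ℝ F p (a, b, c) = a * pd et F p + b * pd ex F p + c * pd eu F p := by
  have : ((a, b, c) : ℝ × ℝ × ℝ) = a • et + b • ex + c • eu := by simp [et, ex, eu]
  rw [this]
  simp [pd]

theorem hasDerivAt_t {t x u : ℝ} (h : DifferentiableAt ℝ F (t, x, u)) :
    HasDerivAt (fun s => F (s, x, u)) (pd et F (t, x, u)) t :=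
  h.hasFDerivAt.comp_hasDerivAt t
    ((hasDerivAt_id t).prodMk ((hasDerivAt_const t x).prodMk (hasDerivAt_const t u)))

theorem hasDerivAt_x {t x u : ℝ} (h : DifferentiableAt ℝ F (t, x, u)) :
    HasDerivAt (fun s => F (t, s, u)) (pd ex F (t, x, u)) x :=
  h.hasFDerivAt.comp_hasDerivAt x
    ((hasDerivAt_const x t).prodMk ((hasDerivAt_id x).prodMk (hasDerivAt_const x u)))

theorem hasDerivAt_u {t x u : ℝ} (h : DifferentiableAt ℝ F (t, x, u)) :
    HasDerivAt (fun s => F (t, x, s)) (pd eu F (t, x, u)) u :=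
  h.hasFDerivAt.comp_hasDerivAt u
    ((hasDerivAt_const u t).prodMk ((hasDerivAt_const u x).prodMk (hasDerivAt_id u)))

theorem eventually_mem_t (hS : IsOpen S) {t x u : ℝ} (h : (t, x, u) ∈ S) :
    ∀ᶠ s in nhds t, (s, x, u) ∈ S :=
  (Continuous.continuousAt (f := fun s : ℝ => (s, x, u)) (by fun_prop)).eventually
    (hS.mem_nhds h)

theorem eventually_mem_x (hS : IsOpen S) {t x u : ℝ} (h : (t, x, u) ∈ S) :
    ∀ᶠ s in nhds x, (t, s, u) ∈ S :=
  (Continuous.continuousAt (f := fun s : ℝ => (t, s, u)) (by fun_prop)).eventually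
    (hS.mem_nhds h)

theorem eventually_mem_u (hS : IsOpen S) {t x u : ℝ} (h : (t, x, u) ∈ S) :
    ∀ᶠ s in nhds u, (t, x, s) ∈ S :=
  (Continuous.continuousAt (f := fun s : ℝ => (t, x, s)) (by fun_prop)).eventually
    (hS.mem_nhds h)

/-- A smooth function on an open set with connected sections `t = const` whose derivatives with
respect to `x` and `u` vanish is a smooth function of `t`. -/
theorem exists_function_of_t (hS : IsOpen S)
    (hc : ∀ t : ℝ, IsPreconnected {q : ℝ × ℝ | (t, q.1, q.2) ∈ S}) (hF : ContDiffOn ℝ ∞ F S)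
    (hx : ∀ p ∈ S, pd ex F p = 0) (hu : ∀ p ∈ S, pd eu F p = 0) :
    ∃ f : ℝ → ℝ, ContDiffOn ℝ ∞ f (projT S) ∧ ∀ t x u : ℝ, (t, x, u) ∈ S → F (t, x, u) = f t := by
  have key : ∀ t x u y v : ℝ, (t, x, u) ∈ S → (t, y, v) ∈ S → F (t, x, u) = F (t, y, v) := by
    intro t x u y v h1 h2
    have hder : ∀ q : ℝ × ℝ, (t, q.1, q.2) ∈ S →
        HasFDerivAt (fun q : ℝ × ℝ => F (t, q.1, q.2)) (0 : ℝ × ℝ →L[ℝ] ℝ) q := by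
      intro q hq
      have h := (differentiableAt_of_smooth hS hF hq).hasFDerivAt.comp q
        ((hasFDerivAt_const t q).prodMk ((hasFDerivAt_id q)))
      refine h.congr_fderiv ?_
      ext
      · simpa [pd, ex] using hx _ hq
      · simpa [pd, eu] using hu _ hq
    have hopen : IsOpen {q : ℝ × ℝ | (t, q.1, q.2) ∈ S} :=
      hS.preimage (by fun_prop : Continuous fun q : ℝ × ℝ => (t, q.1, q.2))
    exact hopen.is_const_of_fderiv_eq_zero (𝕜 := ℝ) (hc t)
      (f := fun q : ℝ × ℝ => F (t, q.1, q.2))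
      (fun q hq => (hder q hq).differentiableAt.differentiableWithinAt)
      (fun q hq => (hder q hq).fderiv) (x := (x, u)) (y := (y, v)) h1 h2
  have hex : ∀ t : ℝ, ∃ a : ℝ, ∀ x u : ℝ, (t, x, u) ∈ S → F (t, x, u) = a := by
    intro t
    by_cases h : ∃ q : ℝ × ℝ, (t, q.1, q.2) ∈ S
    · obtain ⟨q, hq⟩ := h
      exact ⟨F (t, q.1, q.2), fun x u hxu => key _ _ _ _ _ hxu hq⟩
    -- The section is empty, so the value 0 is arbitrary.
    · exact ⟨0, fun x u hxu => absurd ⟨(x, u), hxu⟩ h⟩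
  choose f hf using hex
  refine ⟨f, ?_, hf⟩
  rintro _ ⟨⟨t, x, u⟩, hp, rfl⟩
  -- Near t the function agrees with F along the line with x and u fixed, which stays in the open
  -- set S.
  have h : ContDiffAt ℝ ∞ (fun s : ℝ => F (s, x, u)) t :=
    ContDiffAt.comp (f := fun s : ℝ => (s, x, u)) t (hF.contDiffAt (hS.mem_nhds hp)) (by fun_prop)
  refine (h.congr_of_eventuallyEq ?_).contDiffWithinAt
  filter_upwards [eventually_mem_t hS hp] with s hs
  exact (hf s x u hs).symm

theorem hasDerivAt_function_of_t (hS : IsOpen S) (hF : ContDiffOn ℝ ∞ F S) {f : ℝ → ℝ}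
    (h : ∀ t x u : ℝ, (t, x, u) ∈ S → F (t, x, u) = f t) {t x u : ℝ} (hp : (t, x, u) ∈ S) :
    HasDerivAt f (pd et F (t, x, u)) t := by
  refine (hasDerivAt_t (differentiableAt_of_smooth hS hF hp)).congr_of_eventuallyEq ?_
  filter_upwards [eventually_mem_t hS hp] with s hs
  exact (h s x u hs).symm

end PartialDerivatives

/-! ### Total derivatives in coordinates -/

section Prolongation

variable {S : Set (ℝ × ℝ × ℝ)} {F : ℝ × ℝ × ℝ → ℝ} (z : Jet)

theorem Dt_eq : Dt F z = pd et F z.pt + z.ut * pd eu F z.pt := by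
  simp [Dt, Jet.vt, fderiv_apply_eq]

theorem Dx_eq : Dx F z = pd ex F z.pt + z.ux * pd eu F z.pt := by
  simp [Dx, Jet.vx, fderiv_apply_eq]

theorem Dtt_eq : Dtt F z = fderiv ℝ (fderiv ℝ F) z.pt z.vt z.vt + z.utt * pd eu F z.pt := rfl

theorem Dxx_eq (hS : IsOpen S) (hF : ContDiffOn ℝ ∞ F S) (hp : z.pt ∈ S) :
    Dxx F z = pd ex (pd ex F) z.pt + 2 * z.ux * pd ex (pd eu F) z.pt
      + z.ux ^ 2 * pd eu (pd eu F) z.pt + z.uxx * pd eu F z.pt := by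
  have hv : z.vx = ex + z.ux • eu := by simp [Jet.vx, ex, eu]
  have hu : fderiv ℝ F z.pt (0, 0, 1) = pd eu F z.pt := rfl
  rw [Dxx, hu, hv]
  simp only [map_add, map_smul, add_apply, smul_apply,
    fderiv_fderiv_apply hS hF hp, smul_eq_mul]
  rw [pd_comm hS hF hp eu ex]
  ring

end Prolongation

/-! ### Nondegeneracy and existence of prolonged jets -/

namespace PointTransformation

variable (φ : PointTransformation)

theorem isOpen_dom : IsOpen φ.dom := φ.toHomeo.open_source

theorem smooth_tComp : ContDiffOn ℝ ∞ φ.tComp φ.dom := φ.smooth.fst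

theorem smooth_xComp : ContDiffOn ℝ ∞ φ.xComp φ.dom := φ.smooth.snd.fst

theorem smooth_uComp : ContDiffOn ℝ ∞ φ.uComp φ.dom := φ.smooth.snd.snd

/-- The derivative of φ has a left inverse, the derivative of the inverse transformation. -/
theorem fderiv_injective {p v : ℝ × ℝ × ℝ} (hp : p ∈ φ.dom) (ht : fderiv ℝ φ.tComp p v = 0)
    (hx : fderiv ℝ φ.xComp p v = 0) (hu : fderiv ℝ φ.uComp p v = 0) : v = 0 := by
  have hT := (differentiableAt_of_smooth φ.isOpen_dom φ.smooth_tComp hp).hasFDerivAt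
  have hX := (differentiableAt_of_smooth φ.isOpen_dom φ.smooth_xComp hp).hasFDerivAt
  have hU := (differentiableAt_of_smooth φ.isOpen_dom φ.smooth_uComp hp).hasFDerivAt
  have hφ : HasFDerivAt φ.toHomeo
      ((fderiv ℝ φ.tComp p).prod ((fderiv ℝ φ.xComp p).prod (fderiv ℝ φ.uComp p))) p :=
    hT.prodMk (hX.prodMk hU)
  have hq : φ.toHomeo p ∈ φ.toHomeo.target := φ.toHomeo.map_source hp
  have hψ : HasFDerivAt φ.toHomeo.symm _ (φ.toHomeo p) :=
    ((φ.smooth_symm.contDiffAt (φ.toHomeo.open_target.mem_nhds hq)).differentiableAt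
      (by simp)).hasFDerivAt
  have hid : HasFDerivAt (fun q => φ.toHomeo.symm (φ.toHomeo q)) (ContinuousLinearMap.id ℝ _) p := by
    refine (hasFDerivAt_id p).congr_of_eventuallyEq ?_
    filter_upwards [φ.isOpen_dom.mem_nhds hp] with q hq
    exact φ.toHomeo.left_inv hq
  have h := congrArg (fun L => L v) ((hψ.comp p hφ).unique hid)
  simpa [ht, hx, hu, Prod.zero_eq_mk.symm] using h.symm

/-- The Jacobian determinant of a point transformation. -/
noncomputable def jac (p : ℝ × ℝ × ℝ) : ℝ :=
  pd eu φ.uComp p * (pd et φ.tComp p * pd ex φ.xComp p - pd ex φ.tComp p * pd et φ.xComp p)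
  + pd ex φ.uComp p * (pd eu φ.tComp p * pd et φ.xComp p - pd et φ.tComp p * pd eu φ.xComp p)
  + pd et φ.uComp p * (pd ex φ.tComp p * pd eu φ.xComp p - pd eu φ.tComp p * pd ex φ.xComp p)

theorem jac_ne_zero {p : ℝ × ℝ × ℝ} (hp : p ∈ φ.dom) : φ.jac p ≠ 0 := by
  intro h0
  have inj : ∀ a b c : ℝ,
      a * pd et φ.tComp p + b * pd ex φ.tComp p + c * pd eu φ.tComp p = 0 →
      a * pd et φ.xComp p + b * pd ex φ.xComp p + c * pd eu φ.xComp p = 0 →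
      a * pd et φ.uComp p + b * pd ex φ.uComp p + c * pd eu φ.uComp p = 0 →
      a = 0 ∧ b = 0 ∧ c = 0 := by
    intro a b c h1 h2 h3
    have := φ.fderiv_injective (v := (a, b, c)) hp (by rw [fderiv_apply_eq, h1])
      (by rw [fderiv_apply_eq, h2]) (by rw [fderiv_apply_eq, h3])
    simpa [Prod.ext_iff] using this
  unfold jac at h0
  generalize pd et φ.tComp p = a1 at *
  generalize pd ex φ.tComp p = a2 at *
  generalize pd eu φ.tComp p = a3 at *
  generalize pd et φ.xComp p = b1 at *
  generalize pd ex φ.xComp p = b2 at *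
  generalize pd eu φ.xComp p = b3 at *
  generalize pd et φ.uComp p = c1 at *
  generalize pd ex φ.uComp p = c2 at *
  generalize pd eu φ.uComp p = c3 at *
  -- If the determinant vanishes, the cross product of any two rows lies in the kernel, so all 2 × 2
  -- minors vanish. Vectors such as (a2, -a1, 0) are then in the kernel too, which kills the first
  -- column and puts (1, 0, 0) in the kernel.
  obtain ⟨h1, h2, h3⟩ := inj (a2 * b3 - a3 * b2) (a3 * b1 - a1 * b3) (a1 * b2 - a2 * b1)
    (by ring) (by ring) (by linear_combination h0)
  obtain ⟨h4, h5, h6⟩ := inj (a2 * c3 - a3 * c2) (a3 * c1 - a1 * c3) (a1 * c2 - a2 * c1)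
    (by ring) (by linear_combination -h0) (by ring)
  obtain ⟨h7, h8, h9⟩ := inj (b2 * c3 - b3 * c2) (b3 * c1 - b1 * c3) (b1 * c2 - b2 * c1)
    (by linear_combination h0) (by ring) (by ring)
  obtain ⟨ha2, ha1, -⟩ := inj a2 (-a1) 0 (by ring) (by linear_combination -h3)
    (by linear_combination -h6)
  obtain ⟨ha3, -, -⟩ := inj a3 0 (-a1) (by ring) (by linear_combination h2)
    (by linear_combination h5)
  obtain ⟨hb2, hb1, -⟩ := inj b2 (-b1) 0 (by linear_combination h3) (by ring)
    (by linear_combination -h9)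
  obtain ⟨hb3, -, -⟩ := inj b3 0 (-b1) (by linear_combination -h2) (by ring)
    (by linear_combination h8)
  have ha1' : a1 = 0 := by linarith
  have hb1' : b1 = 0 := by linarith
  obtain ⟨-, hc1, -⟩ := inj c2 (-c1) 0 (by rw [ha1', ha2]; ring) (by rw [hb1', hb2]; ring) (by ring)
  have hc1' : c1 = 0 := by linarith
  obtain ⟨h, -, -⟩ := inj 1 0 0 (by rw [ha1']; ring) (by rw [hb1']; ring) (by rw [hc1']; ring)
  exact one_ne_zero h

/-- A jet is mapped by the prolonged transformation as soon as the transformation of the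
independent variables along the jet is nondegenerate. -/
theorem exists_prolongs {z : Jet} (hz : z.pt ∈ φ.dom)
    (hΔ : Dt φ.tComp z * Dx φ.xComp z - Dx φ.tComp z * Dt φ.xComp z ≠ 0) :
    ∃ w : Jet, φ.Prolongs z w := by
  -- Cramer's rule for a 2 × 2 system with determinant Δ.
  have h1 : ∀ a b c d r s : ℝ, a * d - c * b ≠ 0 →
      ∃ y y' : ℝ, r = y * a + y' * b ∧ s = y * c + y' * d := by
    intro a b c d r s h
    refine ⟨(r * d - s * b) / (a * d - c * b), (a * s - c * r) / (a * d - c * b), ?_, ?_⟩ <;>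
    · rw [div_mul_eq_mul_div, div_mul_eq_mul_div, ← add_div, eq_div_iff h]
      ring
  obtain ⟨wt, wx, ht, hx⟩ := h1 _ _ _ _ (Dt φ.uComp z) (Dx φ.uComp z) hΔ
  -- Here y1, y2 play the role of D_t ũ_t and D_t ũ_x, and y3, y4 that of D_x ũ_t and D_x ũ_x. A
  -- second inversion gives the second derivatives of the image jet, the mixed one twice; the two
  -- values agree because the D_t D_x residual enters both systems.
  obtain ⟨y1, y2, h3, h4⟩ := h1 _ _ _ _
    (Dtt φ.uComp z - wt * Dtt φ.tComp z - wx * Dtt φ.xComp z)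
    (Dtx φ.uComp z - wt * Dtx φ.tComp z - wx * Dtx φ.xComp z) hΔ
  obtain ⟨y3, y4, h5, h6⟩ := h1 _ _ _ _
    (Dtx φ.uComp z - wt * Dtx φ.tComp z - wx * Dtx φ.xComp z)
    (Dxx φ.uComp z - wt * Dxx φ.tComp z - wx * Dxx φ.xComp z) hΔ
  obtain ⟨wtt, wtx, h7, h8⟩ := h1 _ _ _ _ y1 y3 hΔ
  obtain ⟨wtx', wxx, h9, h10⟩ := h1 _ _ _ _ y2 y4 hΔ
  have hsymm : wtx' = wtx := by
    have h : (Dt φ.tComp z * Dx φ.xComp z - Dx φ.tComp z * Dt φ.xComp z) * (wtx - wtx') = 0 := by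
      linear_combination Dx φ.tComp z * h7 - Dt φ.tComp z * h8 + Dx φ.xComp z * h9
        - Dt φ.xComp z * h10 + h4 - h5
    linarith [(mul_eq_zero.mp h).resolve_left hΔ]
  subst hsymm
  refine ⟨⟨φ.tComp z.pt, φ.xComp z.pt, φ.uComp z.pt, wt, wx, wtt, wtx', wxx⟩, hz, rfl, ht, hx,
    ?_, ?_, ?_⟩
  · linear_combination h3 + Dt φ.tComp z * h7 + Dt φ.xComp z * h9
  · linear_combination h4 + Dx φ.tComp z * h7 + Dx φ.xComp z * h9
  · linear_combination h6 + Dx φ.tComp z * h8 + Dx φ.xComp z * h10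

end PointTransformation

/-! ### Elimination in the prolongation formulas -/

namespace PointTransformation

variable {φ : PointTransformation} {z w : Jet}

/-- The combination D_x T · D_t - D_t T · D_x annihilates T and sends X to -Δ, so its square removes
ũ_tt and ũ_tx from the second-order relations. -/
theorem Prolongs.sq_mul_uxx (h : φ.Prolongs z w) :
    (Dt φ.tComp z * Dx φ.xComp z - Dx φ.tComp z * Dt φ.xComp z) ^ 2 * w.uxx =
      Dx φ.tComp z ^ 2 * (Dtt φ.uComp z - w.ut * Dtt φ.tComp z - w.ux * Dtt φ.xComp z)
      - 2 * Dx φ.tComp z * Dt φ.tComp z *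
        (Dtx φ.uComp z - w.ut * Dtx φ.tComp z - w.ux * Dtx φ.xComp z)
      + Dt φ.tComp z ^ 2 * (Dxx φ.uComp z - w.ut * Dxx φ.tComp z - w.ux * Dxx φ.xComp z) := by
  linear_combination -Dx φ.tComp z ^ 2 * h.dtt + 2 * Dx φ.tComp z * Dt φ.tComp z * h.dtx
    - Dt φ.tComp z ^ 2 * h.dxx

/-- In the frame ∂_t + u_t ∂_u, ∂_x + u_x ∂_u, ∂_u the row of U - ũ_t T - ũ_x X has zeros in its
first two places by the first-order relations, so the Jacobian determinant factors. It follows that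
the second factor is nonzero. -/
theorem Prolongs.jac_eq (h : φ.Prolongs z w) :
    (Dt φ.tComp z * Dx φ.xComp z - Dx φ.tComp z * Dt φ.xComp z) *
      (pd eu φ.uComp z.pt - w.ut * pd eu φ.tComp z.pt - w.ux * pd eu φ.xComp z.pt) =
      φ.jac z.pt := by
  have h1 := h.dt
  have h2 := h.dx
  simp only [Dt_eq, Dx_eq] at h1 h2 ⊢
  unfold jac
  linear_combination
    (pd ex φ.xComp z.pt * pd eu φ.tComp z.pt - pd ex φ.tComp z.pt * pd eu φ.xComp z.pt) * h1
    + (pd et φ.tComp z.pt * pd eu φ.xComp z.pt - pd et φ.xComp z.pt * pd eu φ.tComp z.pt) * h2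

end PointTransformation

/-! ### Necessity: splitting with respect to the jet variables -/

section Forward

variable {θ θ' : ArbitraryElements} {φ : PointTransformation}

theorem mem_projTX {S : Set (ℝ × ℝ × ℝ)} {t x u : ℝ} (h : (t, x, u) ∈ S) : (t, x) ∈ projTX S :=
  ⟨_, h, rfl⟩

theorem mem_projT {S : Set (ℝ × ℝ × ℝ)} {t x u : ℝ} (h : (t, x, u) ∈ S) : t ∈ projT S :=
  ⟨_, h, rfl⟩

theorem A2_ne_zero_of_prolongs (hθ' : θ'.InClass φ.ran) {z w : Jet} (h : φ.Prolongs z w) :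
    θ'.A2 (w.t, w.x) ≠ 0 := by
  refine hθ'.ne_zero _ ⟨w.pt, ?_, rfl⟩
  rw [h.pt]
  exact φ.toHomeo.map_source h.mem

/-- An admissible transformation preserves the time foliation along every jet for which the
transformation of the independent variables is nondegenerate. -/
theorem Dx_tComp_eq_zero (hθ : θ.InClass φ.dom) (hθ' : θ'.InClass φ.ran)
    (hpres : ∀ z w : Jet, φ.Prolongs z w → z ∈ θ.equation → w ∈ θ'.equation)
    {t x u : ℝ} (hp : (t, x, u) ∈ φ.dom) (ut ux : ℝ)
    (hΔ : (pd et φ.tComp (t, x, u) + ut * pd eu φ.tComp (t, x, u)) *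
        (pd ex φ.xComp (t, x, u) + ux * pd eu φ.xComp (t, x, u)) -
      (pd ex φ.tComp (t, x, u) + ux * pd eu φ.tComp (t, x, u)) *
        (pd et φ.xComp (t, x, u) + ut * pd eu φ.xComp (t, x, u)) ≠ 0) :
    pd ex φ.tComp (t, x, u) + ux * pd eu φ.tComp (t, x, u) = 0 := by
  have hA := hθ.ne_zero _ (mem_projTX hp)
  set uxx : ℝ := (ut + u * ux - (θ.A11 t * x + θ.A10 t) * ux) / θ.A2 (t, x) with huxx
  have heq : ∀ s : ℝ, (⟨t, x, u, ut, ux, s, 0, uxx⟩ : Jet) ∈ θ.equation := by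
    intro s
    change ut + u * ux = θ.A2 (t, x) * uxx + (θ.A11 t * x + θ.A10 t) * ux
    rw [huxx]
    field_simp
    ring
  -- Two jets on the source equation that differ in u_tt only; their images are shown to share all
  -- of the first-order part and ũ_xx.
  set z0 : Jet := ⟨t, x, u, ut, ux, 0, 0, uxx⟩ with hz0
  set z1 : Jet := ⟨t, x, u, ut, ux, 1, 0, uxx⟩ with hz1
  have hΔ0 : Dt φ.tComp z0 * Dx φ.xComp z0 - Dx φ.tComp z0 * Dt φ.xComp z0 ≠ 0 := by
    simp only [Dt_eq, Dx_eq]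
    exact hΔ
  obtain ⟨w0, hw0⟩ := φ.exists_prolongs (z := z0) hp hΔ0
  obtain ⟨w1, hw1⟩ := φ.exists_prolongs (z := z1) hp hΔ0
  have e0 : w0.ut + w0.u * w0.ux = _ := hpres _ _ hw0 (heq 0)
  have e1 : w1.ut + w1.u * w1.ux = _ := hpres _ _ hw1 (heq 1)
  have hA' := A2_ne_zero_of_prolongs hθ' hw0
  have hpt : w1.pt = w0.pt := hw1.pt.trans hw0.pt.symm
  obtain ⟨ht, hx, hu⟩ : w1.t = w0.t ∧ w1.x = w0.x ∧ w1.u = w0.u := by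
    simpa [Jet.pt] using hpt
  have hDt : ∀ F, Dt F z1 = Dt F z0 := fun _ => rfl
  have hDx : ∀ F, Dx F z1 = Dx F z0 := fun _ => rfl
  have hDtx : ∀ F, Dtx F z1 = Dtx F z0 := fun _ => rfl
  have hDxx : ∀ F, Dxx F z1 = Dxx F z0 := fun _ => rfl
  have hDtt : ∀ F, Dtt F z1 = Dtt F z0 + pd eu F (t, x, u) := by
    intro F
    rw [Dtt_eq, Dtt_eq]
    change _ + 1 * pd eu F (t, x, u) = _ + 0 * pd eu F (t, x, u) + _
    rw [one_mul, zero_mul, add_zero]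
    rfl
  have d0 := hw0.dt
  have d1 := hw1.dt
  have c0 := hw0.dx
  have c1 := hw1.dx
  have s0 := hw0.sq_mul_uxx
  have s1 := hw1.sq_mul_uxx
  have hJ := hw0.jac_eq
  have hjac : φ.jac z0.pt ≠ 0 := φ.jac_ne_zero hp
  simp only [hDt, hDx, hDtx, hDxx, hDtt] at d1 c1 s1
  have hwx : w1.ux = w0.ux := by
    have : (Dt φ.tComp z0 * Dx φ.xComp z0 - Dx φ.tComp z0 * Dt φ.xComp z0)
        * (w1.ux - w0.ux) = 0 := by
      linear_combination Dt φ.tComp z0 * (c0 - c1) - Dx φ.tComp z0 * (d0 - d1)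
    linarith [(mul_eq_zero.mp this).resolve_left hΔ0]
  have hwt : w1.ut = w0.ut := by
    have : (Dt φ.tComp z0 * Dx φ.xComp z0 - Dx φ.tComp z0 * Dt φ.xComp z0)
        * (w1.ut - w0.ut) = 0 := by
      linear_combination Dx φ.xComp z0 * (d0 - d1) - Dt φ.xComp z0 * (c0 - c1)
    linarith [(mul_eq_zero.mp this).resolve_left hΔ0]
  rw [hwx, hwt, ht, hx, hu] at e1
  have hwxx : w1.uxx = w0.uxx := by
    have : θ'.A2 (w0.t, w0.x) * (w1.uxx - w0.uxx) = 0 := by linear_combination e0 - e1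
    linarith [(mul_eq_zero.mp this).resolve_left hA']
  rw [hwx, hwt, hwxx] at s1
  have hJ0 : pd eu φ.uComp (t, x, u) - w0.ut * pd eu φ.tComp (t, x, u)
      - w0.ux * pd eu φ.xComp (t, x, u) ≠ 0 := by
    intro h0
    apply hjac
    rw [← hJ]
    exact mul_eq_zero_of_right _ h0
  have hmul : Dx φ.tComp z0 ^ 2 * (pd eu φ.uComp (t, x, u) - w0.ut * pd eu φ.tComp (t, x, u)
      - w0.ux * pd eu φ.xComp (t, x, u)) = 0 := by
    linear_combination s0 - s1
  have := pow_eq_zero_iff (two_ne_zero) |>.mp ((mul_eq_zero.mp hmul).resolve_right hJ0)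
  rwa [Dx_eq] at this

/-- A nonzero affine function of (r, s) is nonzero at points with two different values of r, and
these are two roots of p + r q. -/
theorem eq_zero_of_affine {a b c p q : ℝ} (hne : ¬(a = 0 ∧ b = 0 ∧ c = 0))
    (h : ∀ r s : ℝ, a + b * r + c * s ≠ 0 → p + r * q = 0) : p = 0 ∧ q = 0 := by
  have two : ∀ r r' : ℝ, r ≠ r' → p + r * q = 0 → p + r' * q = 0 → p = 0 ∧ q = 0 := by
    intro r r' hr h1 h2
    have hq : q = 0 := by
      have : (r - r') * q = 0 := by linear_combination h1 - h2
      exact (mul_eq_zero.mp this).resolve_left (sub_ne_zero.mpr hr)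
    subst hq
    exact ⟨by linarith, rfl⟩
  by_cases hc : c = 0
  · subst hc
    by_cases h0 : a = 0
    · subst h0
      have hb : b ≠ 0 := fun hb => hne ⟨rfl, hb, rfl⟩
      exact two 1 2 (by norm_num) (h 1 0 (by simpa using hb)) (h 2 0 (by simpa using hb))
    · by_cases h1 : a + b = 0
      · refine two 0 2 (by norm_num) (h 0 0 (by simpa using h0)) (h 2 0 ?_)
        intro h2
        exact h0 (by linarith)
      · exact two 0 1 (by norm_num) (h 0 0 (by simpa using h0)) (h 1 0 (by simpa using h1))
  · have all : ∀ r : ℝ, p + r * q = 0 := by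
      intro r
      refine h r ((1 - a - b * r) / c) ?_
      field_simp
      norm_num
    exact two 0 1 (by norm_num) (all 0) (all 1)

theorem pd_tComp_eq_zero (hθ : θ.InClass φ.dom) (hθ' : θ'.InClass φ.ran)
    (hpres : ∀ z w : Jet, φ.Prolongs z w → z ∈ θ.equation → w ∈ θ'.equation)
    {p : ℝ × ℝ × ℝ} (hp : p ∈ φ.dom) : pd ex φ.tComp p = 0 ∧ pd eu φ.tComp p = 0 := by
  obtain ⟨t, x, u⟩ := p
  have hjac := φ.jac_ne_zero hp
  unfold PointTransformation.jac at hjac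
  -- The u_t u_x terms of Δ cancel, so Δ is affine in r = u_x and s = u_t. Its three coefficients
  -- are, up to sign, the cofactors of the derivatives of U in the Jacobian, hence not all zero.
  refine eq_zero_of_affine
    (a := pd et φ.tComp (t, x, u) * pd ex φ.xComp (t, x, u)
      - pd ex φ.tComp (t, x, u) * pd et φ.xComp (t, x, u))
    (b := pd et φ.tComp (t, x, u) * pd eu φ.xComp (t, x, u)
      - pd eu φ.tComp (t, x, u) * pd et φ.xComp (t, x, u))
    (c := pd eu φ.tComp (t, x, u) * pd ex φ.xComp (t, x, u)
      - pd ex φ.tComp (t, x, u) * pd eu φ.xComp (t, x, u)) ?_ ?_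
  · rintro ⟨ha, hb, hc⟩
    apply hjac
    linear_combination pd eu φ.uComp (t, x, u) * ha - pd ex φ.uComp (t, x, u) * hb
      - pd et φ.uComp (t, x, u) * hc
  · intro r s hrs
    refine Dx_tComp_eq_zero hθ hθ' hpres hp s r ?_
    intro h0
    apply hrs
    linear_combination h0

/-- The conditions on a transformation with `t̃` depending on `t` only: the jets of the source
equation are parametrized by `u_x` and `u_xx`. -/
theorem reduced_system (hθ : θ.InClass φ.dom) (hθ' : θ'.InClass φ.ran)
    (hpres : ∀ z w : Jet, φ.Prolongs z w → z ∈ θ.equation → w ∈ θ'.equation)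
    {t x u : ℝ} (hp : (t, x, u) ∈ φ.dom) (ux uxx ut : ℝ)
    (hut : ut = θ.A2 (t, x) * uxx + (θ.A11 t * x + θ.A10 t - u) * ux)
    (hD : pd ex φ.xComp (t, x, u) + ux * pd eu φ.xComp (t, x, u) ≠ 0) :
    ∃ wt wx wxx : ℝ,
      pd ex φ.uComp (t, x, u) + ux * pd eu φ.uComp (t, x, u)
        = wx * (pd ex φ.xComp (t, x, u) + ux * pd eu φ.xComp (t, x, u)) ∧
      pd et φ.uComp (t, x, u) + ut * pd eu φ.uComp (t, x, u)
        = wt * pd et φ.tComp (t, x, u)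
          + wx * (pd et φ.xComp (t, x, u) + ut * pd eu φ.xComp (t, x, u)) ∧
      pd ex (pd ex φ.uComp) (t, x, u) + 2 * ux * pd ex (pd eu φ.uComp) (t, x, u)
          + ux ^ 2 * pd eu (pd eu φ.uComp) (t, x, u) + uxx * pd eu φ.uComp (t, x, u)
        = wx * (pd ex (pd ex φ.xComp) (t, x, u) + 2 * ux * pd ex (pd eu φ.xComp) (t, x, u)
          + ux ^ 2 * pd eu (pd eu φ.xComp) (t, x, u) + uxx * pd eu φ.xComp (t, x, u))
          + wxx * (pd ex φ.xComp (t, x, u) + ux * pd eu φ.xComp (t, x, u)) ^ 2 ∧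
      wt + φ.uComp (t, x, u) * wx
        = θ'.A2 (φ.tComp (t, x, u), φ.xComp (t, x, u)) * wxx
          + (θ'.A11 (φ.tComp (t, x, u)) * φ.xComp (t, x, u) + θ'.A10 (φ.tComp (t, x, u))) * wx := by
  have hT : ∀ p ∈ φ.dom, pd ex φ.tComp p = 0 := fun p hp => (pd_tComp_eq_zero hθ hθ' hpres hp).1
  have hT' : ∀ p ∈ φ.dom, pd eu φ.tComp p = 0 := fun p hp => (pd_tComp_eq_zero hθ hθ' hpres hp).2
  have hjac := φ.jac_ne_zero hp
  have hTt : pd et φ.tComp (t, x, u) ≠ 0 := by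
    intro h0
    apply hjac
    simp [PointTransformation.jac, hT _ hp, hT' _ hp, h0]
  have hdom := φ.isOpen_dom
  -- The zeros for u_tt and u_tx are arbitrary: with D_x T = 0 the relations that are kept contain
  -- neither.
  set z : Jet := ⟨t, x, u, ut, ux, 0, 0, uxx⟩ with hz
  have hzpt : z.pt = (t, x, u) := rfl
  obtain ⟨w, hw⟩ := φ.exists_prolongs (z := z) hp (by
    simp only [Dt_eq, Dx_eq, hzpt, hT _ hp, hT' _ hp, mul_zero, add_zero, zero_mul, sub_zero]
    exact mul_ne_zero hTt hD)
  have hweq : w.ut + w.u * w.ux = θ'.A2 (w.t, w.x) * w.uxx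
      + (θ'.A11 w.t * w.x + θ'.A10 w.t) * w.ux := by
    refine hpres _ _ hw ?_
    change ut + u * ux = θ.A2 (t, x) * uxx + (θ.A11 t * x + θ.A10 t) * ux
    rw [hut]
    ring
  obtain ⟨ht, hx, hu⟩ : w.t = φ.tComp (t, x, u) ∧ w.x = φ.xComp (t, x, u) ∧
      w.u = φ.uComp (t, x, u) := by
    simpa [Jet.pt] using hw.pt
  rw [ht, hx, hu] at hweq
  have hdt := hw.dt
  have hdx := hw.dx
  have hdxx := hw.dxx
  rw [Dxx_eq z hdom φ.smooth_tComp hp, Dxx_eq z hdom φ.smooth_xComp hp,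
    Dxx_eq z hdom φ.smooth_uComp hp] at hdxx
  simp only [Dt_eq, Dx_eq, hzpt, hT _ hp, hT' _ hp, pd_eq_zero_of_eq_zero hdom hT hp,
    pd_eq_zero_of_eq_zero hdom hT' hp] at hdt hdx hdxx
  simp only [hz] at hdt hdx hdxx
  exact ⟨w.ut, w.ux, w.uxx, by linear_combination hdx, by linear_combination hdt,
    by linear_combination hdxx, hweq⟩

theorem xComp_conditions (hθ : θ.InClass φ.dom) (hθ' : θ'.InClass φ.ran)
    (hpres : ∀ z w : Jet, φ.Prolongs z w → z ∈ θ.equation → w ∈ θ'.equation)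
    {t x u : ℝ} (hp : (t, x, u) ∈ φ.dom) :
    pd eu φ.xComp (t, x, u) = 0 ∧ pd et φ.tComp (t, x, u) ≠ 0 ∧ pd ex φ.xComp (t, x, u) ≠ 0 ∧
    pd eu φ.uComp (t, x, u) ≠ 0 ∧
    pd ex φ.xComp (t, x, u) ^ 2 * θ.A2 (t, x) =
      pd et φ.tComp (t, x, u) * θ'.A2 (φ.tComp (t, x, u), φ.xComp (t, x, u)) := by
  obtain ⟨hTx, hTu⟩ := pd_tComp_eq_zero hθ hθ' hpres hp
  have hA := hθ.ne_zero _ (mem_projTX hp)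
  have hjac := φ.jac_ne_zero hp
  unfold PointTransformation.jac at hjac
  rw [hTx, hTu] at hjac
  have key : ∀ ux : ℝ, pd ex φ.xComp (t, x, u) + ux * pd eu φ.xComp (t, x, u) ≠ 0 →
      (pd ex φ.xComp (t, x, u) + ux * pd eu φ.xComp (t, x, u)) ^ 2 * θ.A2 (t, x) =
      pd et φ.tComp (t, x, u) * θ'.A2 (φ.tComp (t, x, u), φ.xComp (t, x, u)) := by
    intro ux hD
    -- Comparing u_xx = 0 with u_xx = 1 at the same u_x extracts the coefficient of u_xx; ũ_x is the
    -- same for both.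
    obtain ⟨wt, wx, wxx, h1, h2, h3, h4⟩ := reduced_system hθ hθ' hpres hp ux 0 _ rfl hD
    obtain ⟨vt, vx, vxx, k1, k2, k3, k4⟩ := reduced_system hθ hθ' hpres hp ux 1 _ rfl hD
    have hv : vx = wx := mul_right_cancel₀ hD (k1.symm.trans h1)
    subst hv
    have hJ : pd eu φ.uComp (t, x, u) - vx * pd eu φ.xComp (t, x, u) ≠ 0 := by
      intro h0
      apply hjac
      linear_combination
        pd et φ.tComp (t, x, u) *
          ((pd ex φ.xComp (t, x, u) + ux * pd eu φ.xComp (t, x, u)) * h0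
            - pd eu φ.xComp (t, x, u) * h1)
    refine mul_right_cancel₀ hJ ?_
    linear_combination
      (pd ex φ.xComp (t, x, u) + ux * pd eu φ.xComp (t, x, u)) ^ 2 * (k2 - h2)
      - pd et φ.tComp (t, x, u) * θ'.A2 (φ.tComp (t, x, u), φ.xComp (t, x, u)) * (k3 - h3)
      + pd et φ.tComp (t, x, u) *
        (pd ex φ.xComp (t, x, u) + ux * pd eu φ.xComp (t, x, u)) ^ 2 * (k4 - h4)
  have hXu : pd eu φ.xComp (t, x, u) = 0 := by
    by_contra hXu
    -- If X_u ≠ 0, then u_x can be chosen with D_x X = 1 and with D_x X = 2, which gives A² = 4A²,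
    -- contrary to A² ≠ 0.
    have hval : ∀ c : ℝ, pd ex φ.xComp (t, x, u)
        + (c - pd ex φ.xComp (t, x, u)) / pd eu φ.xComp (t, x, u) * pd eu φ.xComp (t, x, u)
        = c := by
      intro c
      field_simp
      ring
    have h1 := key ((1 - pd ex φ.xComp (t, x, u)) / pd eu φ.xComp (t, x, u))
    have h2 := key ((2 - pd ex φ.xComp (t, x, u)) / pd eu φ.xComp (t, x, u))
    rw [hval] at h1 h2
    exact hA (by linarith [h1 one_ne_zero, h2 two_ne_zero])
  rw [hXu] at hjac
  have hXx : pd ex φ.xComp (t, x, u) ≠ 0 := fun h => hjac (by rw [h]; ring)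
  refine ⟨hXu, fun h => hjac (by rw [h]; ring), hXx, fun h => hjac (by rw [h]; ring), ?_⟩
  have h := key 0
  simp only [zero_mul, add_zero] at h
  exact h hXx

/-- The determining equations obtained by splitting with respect to `u_x`. -/
theorem determining_equations (hθ : θ.InClass φ.dom) (hθ' : θ'.InClass φ.ran)
    (hpres : ∀ z w : Jet, φ.Prolongs z w → z ∈ θ.equation → w ∈ θ'.equation)
    {t x u : ℝ} (hp : (t, x, u) ∈ φ.dom) :
    pd eu (pd eu φ.uComp) (t, x, u) = 0 ∧
    pd eu φ.uComp (t, x, u) *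
      (pd ex φ.xComp (t, x, u) * (θ.A11 t * x + θ.A10 t - u) - pd et φ.xComp (t, x, u)
        + pd et φ.tComp (t, x, u) * φ.uComp (t, x, u)
        + θ.A2 (t, x) * pd ex (pd ex φ.xComp) (t, x, u)
        - pd et φ.tComp (t, x, u) * (θ'.A11 (φ.tComp (t, x, u)) * φ.xComp (t, x, u)
          + θ'.A10 (φ.tComp (t, x, u)))) =
      2 * θ.A2 (t, x) * pd ex φ.xComp (t, x, u) * pd ex (pd eu φ.uComp) (t, x, u) ∧
    pd ex φ.xComp (t, x, u) * pd et φ.uComp (t, x, u) + pd ex φ.uComp (t, x, u) *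
      (pd et φ.tComp (t, x, u) * φ.uComp (t, x, u) - pd et φ.xComp (t, x, u)
        + θ.A2 (t, x) * pd ex (pd ex φ.xComp) (t, x, u)
        - pd et φ.tComp (t, x, u) * (θ'.A11 (φ.tComp (t, x, u)) * φ.xComp (t, x, u)
          + θ'.A10 (φ.tComp (t, x, u)))) =
      θ.A2 (t, x) * pd ex φ.xComp (t, x, u) * pd ex (pd ex φ.uComp) (t, x, u) := by
  obtain ⟨hXu, hTt, hXx, hUu, hA2⟩ := xComp_conditions hθ hθ' hpres hp
  have hA := hθ.ne_zero _ (mem_projTX hp)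
  have hXu' : ∀ p ∈ φ.dom, pd eu φ.xComp p = 0 := fun p hp =>
    (xComp_conditions hθ hθ' hpres hp).1
  have key : ∀ ux : ℝ,
      pd ex φ.xComp (t, x, u) * (pd et φ.uComp (t, x, u)
          + ((θ.A11 t * x + θ.A10 t - u) * ux) * pd eu φ.uComp (t, x, u))
        + (pd ex φ.uComp (t, x, u) + ux * pd eu φ.uComp (t, x, u)) *
      (pd et φ.tComp (t, x, u) * φ.uComp (t, x, u) - pd et φ.xComp (t, x, u)
        + θ.A2 (t, x) * pd ex (pd ex φ.xComp) (t, x, u)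
        - pd et φ.tComp (t, x, u) * (θ'.A11 (φ.tComp (t, x, u)) * φ.xComp (t, x, u)
          + θ'.A10 (φ.tComp (t, x, u)))) =
      θ.A2 (t, x) * pd ex φ.xComp (t, x, u) * (pd ex (pd ex φ.uComp) (t, x, u)
        + 2 * ux * pd ex (pd eu φ.uComp) (t, x, u)
        + ux ^ 2 * pd eu (pd eu φ.uComp) (t, x, u)) := by
    intro ux
    obtain ⟨wt, wx, wxx, h1, h2, h3, h4⟩ := reduced_system hθ hθ' hpres hp ux 0 _ rfl
      (by rwa [hXu, mul_zero, add_zero])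
    rw [pd_eq_zero_of_eq_zero φ.isOpen_dom hXu' hp, pd_eq_zero_of_eq_zero φ.isOpen_dom hXu' hp,
      hXu] at h3
    rw [hXu] at h1 h2
    generalize pd et φ.tComp (t, x, u) = Tt at *
    generalize pd ex φ.xComp (t, x, u) = Xx at *
    generalize pd et φ.xComp (t, x, u) = Xt at *
    generalize pd ex (pd ex φ.xComp) (t, x, u) = Xxx at *
    generalize θ'.A2 (φ.tComp (t, x, u), φ.xComp (t, x, u)) = A2' at *
    linear_combination Xx * h2 - θ.A2 (t, x) * Xx * h3 + Tt * Xx * h4 - Xx * wxx * hA2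
      + (Tt * φ.uComp (t, x, u) - Xt + θ.A2 (t, x) * Xxx
        - Tt * (θ'.A11 (φ.tComp (t, x, u)) * φ.xComp (t, x, u) + θ'.A10 (φ.tComp (t, x, u)))) * h1
  -- A quadratic polynomial in u_x is determined by its values at 0, 1 and -1.
  have k0 := key 0
  have k1 := key 1
  have k2 := key (-1)
  have hUuu : pd eu (pd eu φ.uComp) (t, x, u) = 0 := by
    have : θ.A2 (t, x) * pd ex φ.xComp (t, x, u) * pd eu (pd eu φ.uComp) (t, x, u) = 0 := by
      linear_combination k0 - (k1 + k2) / 2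
    exact (mul_eq_zero.mp this).resolve_left (mul_ne_zero hA hXx)
  exact ⟨hUuu, by linear_combination (k1 - k2) / 2, by linear_combination k0⟩

end Forward

/-! ### Derivatives read off along coordinate lines -/

section

variable {S : Set (ℝ × ℝ × ℝ)} {F : ℝ × ℝ × ℝ → ℝ}

theorem isOpen_projT (hS : IsOpen S) : IsOpen (projT S) := isOpenMap_fst _ hS

theorem pd_et_eq (hS : IsOpen S) (hF : ContDiffOn ℝ ∞ F S) {g : ℝ → ℝ} {t x u c : ℝ}
    (hp : (t, x, u) ∈ S) (h : ∀ s, (s, x, u) ∈ S → F (s, x, u) = g s) (hg : HasDerivAt g c t) :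
    pd et F (t, x, u) = c := by
  refine (hasDerivAt_t (differentiableAt_of_smooth hS hF hp)).unique
    (hg.congr_of_eventuallyEq ?_)
  filter_upwards [eventually_mem_t hS hp] with s hs using h s hs

theorem pd_ex_eq (hS : IsOpen S) (hF : ContDiffOn ℝ ∞ F S) {g : ℝ → ℝ} {t x u c : ℝ}
    (hp : (t, x, u) ∈ S) (h : ∀ s, (t, s, u) ∈ S → F (t, s, u) = g s) (hg : HasDerivAt g c x) :
    pd ex F (t, x, u) = c := by
  refine (hasDerivAt_x (differentiableAt_of_smooth hS hF hp)).unique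
    (hg.congr_of_eventuallyEq ?_)
  filter_upwards [eventually_mem_x hS hp] with s hs using h s hs

theorem pd_eu_eq (hS : IsOpen S) (hF : ContDiffOn ℝ ∞ F S) {g : ℝ → ℝ} {t x u c : ℝ}
    (hp : (t, x, u) ∈ S) (h : ∀ s, (t, x, s) ∈ S → F (t, x, s) = g s) (hg : HasDerivAt g c u) :
    pd eu F (t, x, u) = c := by
  refine (hasDerivAt_u (differentiableAt_of_smooth hS hF hp)).unique
    (hg.congr_of_eventuallyEq ?_)
  filter_upwards [eventually_mem_u hS hp] with s hs using h s hs

theorem pd_ex_eq_zero (hS : IsOpen S) (hF : ContDiffOn ℝ ∞ F S) {f : ℝ → ℝ}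
    (h : ∀ t x u : ℝ, (t, x, u) ∈ S → F (t, x, u) = f t) {p : ℝ × ℝ × ℝ} (hp : p ∈ S) :
    pd ex F p = 0 :=
  pd_ex_eq (t := p.1) (x := p.2.1) (u := p.2.2) hS hF hp (fun _ hs => h _ _ _ hs)
    (hasDerivAt_const _ _)

theorem pd_eu_eq_zero (hS : IsOpen S) (hF : ContDiffOn ℝ ∞ F S) {f : ℝ → ℝ}
    (h : ∀ t x u : ℝ, (t, x, u) ∈ S → F (t, x, u) = f t) {p : ℝ × ℝ × ℝ} (hp : p ∈ S) :
    pd eu F p = 0 :=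
  pd_eu_eq (t := p.1) (x := p.2.1) (u := p.2.2) hS hF hp (fun _ hs => h _ _ _ hs)
    (hasDerivAt_const _ _)

/-- An affine function of `x` that vanishes on a section of an open set vanishes identically. -/
theorem eq_zero_of_affine_on_section (hS : IsOpen S) {t x u a b : ℝ} (hp : (t, x, u) ∈ S)
    (h : ∀ y, (t, y, u) ∈ S → a * y + b = 0) : a = 0 ∧ b = 0 := by
  have ha : a = 0 := by
    have h1 : HasDerivAt (fun y => a * y + b) a x := by
      simpa using ((hasDerivAt_id x).const_mul a).add_const b
    refine h1.unique ((hasDerivAt_const x (0 : ℝ)).congr_of_eventuallyEq ?_)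
    filter_upwards [eventually_mem_x hS hp] with y hy using h y hy
  have := h x hp
  rw [ha] at this
  exact ⟨ha, by linarith⟩

end

/-- The components of a point transformation have the form that is linear in `(x, u)`, with
coefficients `T`, `X⁰`, `U¹` and `U⁰⁰` depending smoothly on `t`. -/
structure HasForm (φ : PointTransformation) (T X0 U1 U00 : ℝ → ℝ) : Prop where
  smoothT : ContDiffOn ℝ ∞ T (projT φ.dom)
  smoothX0 : ContDiffOn ℝ ∞ X0 (projT φ.dom)
  smoothU1 : ContDiffOn ℝ ∞ U1 (projT φ.dom)
  smoothU00 : ContDiffOn ℝ ∞ U00 (projT φ.dom)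
  tComp_eq : ∀ t x u : ℝ, (t, x, u) ∈ φ.dom → φ.tComp (t, x, u) = T t
  xComp_eq : ∀ t x u : ℝ, (t, x, u) ∈ φ.dom → φ.xComp (t, x, u) = deriv T t * U1 t * x + X0 t
  uComp_eq : ∀ t x u : ℝ, (t, x, u) ∈ φ.dom →
    φ.uComp (t, x, u) = U1 t * u - deriv U1 t * x + U00 t

/-! ### Derivatives of the components in the final form -/

namespace HasForm

variable {φ : PointTransformation} {T X0 U1 U00 : ℝ → ℝ}

theorem hasDerivAt {S : Set (ℝ × ℝ × ℝ)} (hS : IsOpen S) {f : ℝ → ℝ}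
    (hf : ContDiffOn ℝ ∞ f (projT S)) {t : ℝ} (ht : t ∈ projT S) : HasDerivAt f (deriv f t) t :=
  ((hf.contDiffAt ((isOpen_projT hS).mem_nhds ht)).differentiableAt (by simp)).hasDerivAt

theorem hasDerivAt_deriv {S : Set (ℝ × ℝ × ℝ)} (hS : IsOpen S) {f : ℝ → ℝ}
    (hf : ContDiffOn ℝ ∞ f (projT S)) {t : ℝ} (ht : t ∈ projT S) :
    HasDerivAt (deriv f) (deriv (deriv f) t) t :=
  hasDerivAt hS (hf.deriv_of_isOpen (isOpen_projT hS) (by simp)) ht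

theorem pd_et_tComp (h : HasForm φ T X0 U1 U00) {t x u : ℝ} (hp : (t, x, u) ∈ φ.dom) :
    pd et φ.tComp (t, x, u) = deriv T t :=
  pd_et_eq φ.isOpen_dom φ.smooth_tComp hp (fun _ hs => h.tComp_eq _ _ _ hs)
    (hasDerivAt φ.isOpen_dom h.smoothT (mem_projT hp))

theorem pd_ex_tComp (h : HasForm φ T X0 U1 U00) : ∀ p ∈ φ.dom, pd ex φ.tComp p = 0 :=
  fun _ hp => pd_ex_eq_zero φ.isOpen_dom φ.smooth_tComp h.tComp_eq hp

theorem pd_eu_tComp (h : HasForm φ T X0 U1 U00) : ∀ p ∈ φ.dom, pd eu φ.tComp p = 0 :=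
  fun _ hp => pd_eu_eq_zero φ.isOpen_dom φ.smooth_tComp h.tComp_eq hp

theorem pd_et_xComp (h : HasForm φ T X0 U1 U00) {t x u : ℝ} (hp : (t, x, u) ∈ φ.dom) :
    pd et φ.xComp (t, x, u)
      = (deriv (deriv T) t * U1 t + deriv T t * deriv U1 t) * x + deriv X0 t :=
  pd_et_eq φ.isOpen_dom φ.smooth_xComp hp (fun _ hs => h.xComp_eq _ _ _ hs)
    ((((hasDerivAt_deriv φ.isOpen_dom h.smoothT (mem_projT hp)).mul
      (hasDerivAt φ.isOpen_dom h.smoothU1 (mem_projT hp))).mul_const x).add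
      (hasDerivAt φ.isOpen_dom h.smoothX0 (mem_projT hp)))

theorem pd_ex_xComp (h : HasForm φ T X0 U1 U00) (t x u : ℝ) (hp : (t, x, u) ∈ φ.dom) :
    pd ex φ.xComp (t, x, u) = deriv T t * U1 t :=
  pd_ex_eq φ.isOpen_dom φ.smooth_xComp hp (fun _ hs => h.xComp_eq _ _ _ hs)
    (by simpa using ((hasDerivAt_id x).const_mul (deriv T t * U1 t)).add_const (X0 t))

theorem pd_eu_xComp (h : HasForm φ T X0 U1 U00) : ∀ p ∈ φ.dom, pd eu φ.xComp p = 0 := by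
  rintro ⟨t, x, u⟩ hp
  exact pd_eu_eq φ.isOpen_dom φ.smooth_xComp hp (fun _ hs => h.xComp_eq _ _ _ hs)
    (hasDerivAt_const _ _)

theorem pd_ex_ex_xComp (h : HasForm φ T X0 U1 U00) :
    ∀ p ∈ φ.dom, pd ex (pd ex φ.xComp) p = 0 :=
  fun _ hp => pd_ex_eq_zero φ.isOpen_dom (contDiffOn_pd φ.isOpen_dom φ.smooth_xComp ex)
    h.pd_ex_xComp hp

theorem pd_et_uComp (h : HasForm φ T X0 U1 U00) {t x u : ℝ} (hp : (t, x, u) ∈ φ.dom) :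
    pd et φ.uComp (t, x, u) = deriv U1 t * u - deriv (deriv U1) t * x + deriv U00 t :=
  pd_et_eq φ.isOpen_dom φ.smooth_uComp hp (fun _ hs => h.uComp_eq _ _ _ hs)
    ((((hasDerivAt φ.isOpen_dom h.smoothU1 (mem_projT hp)).mul_const u).sub
      ((hasDerivAt_deriv φ.isOpen_dom h.smoothU1 (mem_projT hp)).mul_const x)).add
      (hasDerivAt φ.isOpen_dom h.smoothU00 (mem_projT hp)))

theorem pd_ex_uComp (h : HasForm φ T X0 U1 U00) (t x u : ℝ) (hp : (t, x, u) ∈ φ.dom) :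
    pd ex φ.uComp (t, x, u) = -deriv U1 t :=
  pd_ex_eq φ.isOpen_dom φ.smooth_uComp hp (fun _ hs => h.uComp_eq _ _ _ hs)
    (by
      simpa using
        (((hasDerivAt_id x).const_mul (deriv U1 t)).const_sub (U1 t * u)).add_const (U00 t))

theorem pd_eu_uComp (h : HasForm φ T X0 U1 U00) (t x u : ℝ) (hp : (t, x, u) ∈ φ.dom) :
    pd eu φ.uComp (t, x, u) = U1 t :=
  pd_eu_eq φ.isOpen_dom φ.smooth_uComp hp (fun _ hs => h.uComp_eq _ _ _ hs)
    (by
      simpa using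
        (((hasDerivAt_id u).const_mul (U1 t)).sub_const (deriv U1 t * x)).add_const (U00 t))

theorem pd_ex_ex_uComp (h : HasForm φ T X0 U1 U00) :
    ∀ p ∈ φ.dom, pd ex (pd ex φ.uComp) p = 0 :=
  fun _ hp => pd_ex_eq_zero φ.isOpen_dom (contDiffOn_pd φ.isOpen_dom φ.smooth_uComp ex)
    h.pd_ex_uComp hp

theorem pd_ex_eu_uComp (h : HasForm φ T X0 U1 U00) :
    ∀ p ∈ φ.dom, pd ex (pd eu φ.uComp) p = 0 :=
  fun _ hp => pd_ex_eq_zero φ.isOpen_dom (contDiffOn_pd φ.isOpen_dom φ.smooth_uComp eu)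
    h.pd_eu_uComp hp

theorem pd_eu_eu_uComp (h : HasForm φ T X0 U1 U00) :
    ∀ p ∈ φ.dom, pd eu (pd eu φ.uComp) p = 0 :=
  fun _ hp => pd_eu_eq_zero φ.isOpen_dom (contDiffOn_pd φ.isOpen_dom φ.smooth_uComp eu)
    h.pd_eu_uComp hp

end HasForm

/-! ### Sufficiency -/

section Converse

variable {θ θ' : ArbitraryElements} {φ : PointTransformation} {T X0 U1 U00 : ℝ → ℝ}

theorem mem_equation_iff (h : HasForm φ T X0 U1 U00)
    (hne : ∀ t ∈ projT φ.dom, deriv T t * U1 t ≠ 0)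
    (hcl : ∀ t ∈ projT φ.dom, deriv (deriv U1) t = θ.A11 t * deriv U1 t ∧
      deriv U00 t = -(θ.A10 t * deriv U1 t))
    (hA2 : ∀ t x : ℝ, (t, x) ∈ projTX φ.dom →
      θ'.A2 (T t, deriv T t * U1 t * x + X0 t) = U1 t ^ 2 * deriv T t * θ.A2 (t, x))
    (hA1 : ∀ t ∈ projT φ.dom,
      θ'.A11 (T t) =
        1 / deriv T t * (θ.A11 t - deriv (deriv T) t / deriv T t - 2 * deriv U1 t / U1 t) ∧
      θ'.A10 (T t) =
        U1 t * θ.A10 t - deriv X0 t / deriv T t + U00 t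
          - X0 t / deriv T t *
            (θ.A11 t - deriv (deriv T) t / deriv T t - 2 * deriv U1 t / U1 t))
    {z w : Jet} (hw : φ.Prolongs z w) : z ∈ θ.equation ↔ w ∈ θ'.equation := by
  have hdt := hw.dt
  have hdx := hw.dx
  have hdxx := hw.dxx
  have hp := hw.mem
  have hdom := φ.isOpen_dom
  have hzpt : z.pt = (z.t, z.x, z.u) := rfl
  rw [hzpt] at hp
  obtain ⟨ht, hx, hu⟩ : w.t = φ.tComp (z.t, z.x, z.u) ∧ w.x = φ.xComp (z.t, z.x, z.u) ∧
      w.u = φ.uComp (z.t, z.x, z.u) := by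
    simpa [Jet.pt] using hw.pt
  rw [Dxx_eq z hdom φ.smooth_tComp hp, Dxx_eq z hdom φ.smooth_xComp hp,
    Dxx_eq z hdom φ.smooth_uComp hp] at hdxx
  simp only [Dt_eq, Dx_eq, hzpt, h.pd_et_tComp hp, h.pd_ex_tComp _ hp, h.pd_eu_tComp _ hp,
    pd_eq_zero_of_eq_zero hdom h.pd_ex_tComp hp, pd_eq_zero_of_eq_zero hdom h.pd_eu_tComp hp,
    pd_eq_zero_of_eq_zero hdom h.pd_eu_xComp hp, h.pd_et_xComp hp, h.pd_ex_xComp _ _ _ hp,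
    h.pd_eu_xComp _ hp, h.pd_ex_ex_xComp _ hp, h.pd_et_uComp hp, h.pd_ex_uComp _ _ _ hp,
    h.pd_eu_uComp _ _ _ hp, h.pd_ex_ex_uComp _ hp, h.pd_ex_eu_uComp _ hp, h.pd_eu_eu_uComp _ hp]
    at hdt hdx hdxx
  rw [h.tComp_eq _ _ _ hp] at ht
  rw [h.xComp_eq _ _ _ hp] at hx
  rw [h.uComp_eq _ _ _ hp] at hu
  obtain ⟨hT, hU⟩ := mul_ne_zero_iff.mp (hne z.t (mem_projT hp))
  obtain ⟨c1, c2⟩ := hcl z.t (mem_projT hp)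
  have ha2 := hA2 z.t z.x (mem_projTX hp)
  obtain ⟨ha11, ha10⟩ := hA1 z.t (mem_projT hp)
  -- The classifying conditions turn U_t into U_x (A¹¹x + A¹⁰ - u), so that a multiple of the D_x
  -- relation cancels it.
  rw [c1, c2] at hdt
  simp only [ArbitraryElements.equation, Set.mem_ofPred_eq]
  rw [ht, hx, hu, ha2]
  -- The relations for Ã¹¹ and Ã¹⁰ enter only through this combination, free of denominators.
  have hL : deriv T z.t * (θ'.A11 (T z.t) * (deriv T z.t * U1 z.t * z.x + X0 z.t) + θ'.A10 (T z.t))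
      = deriv T z.t * U1 z.t * (θ.A11 z.t * z.x + θ.A10 z.t)
        - (deriv (deriv T) z.t * U1 z.t + 2 * (deriv T z.t * deriv U1 z.t)) * z.x - deriv X0 z.t
        + deriv T z.t * U00 z.t := by
    rw [ha11, ha10]
    field_simp
    ring
  have key : deriv T z.t * ((w.ut + (U1 z.t * z.u - deriv U1 z.t * z.x + U00 z.t) * w.ux)
      - (U1 z.t ^ 2 * deriv T z.t * θ.A2 (z.t, z.x) * w.uxx
        + (θ'.A11 (T z.t) * (deriv T z.t * U1 z.t * z.x + X0 z.t) + θ'.A10 (T z.t)) * w.ux))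
      = U1 z.t * ((z.ut + z.u * z.ux)
        - (θ.A2 (z.t, z.x) * z.uxx + (θ.A11 z.t * z.x + θ.A10 z.t) * z.ux)) := by
    linear_combination -hdt + θ.A2 (z.t, z.x) * hdxx - w.ux * hL
      - (z.u - (θ.A11 z.t * z.x + θ.A10 z.t)) * hdx
  constructor
  · intro he
    rw [sub_eq_zero.mpr he, mul_zero] at key
    exact sub_eq_zero.mp ((mul_eq_zero.mp key).resolve_left hT)
  · intro he
    rw [sub_eq_zero.mpr he, mul_zero] at key
    exact sub_eq_zero.mp ((mul_eq_zero.mp key.symm).resolve_left hU)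

end Converse

/-! ### Necessity: solving the determining equations -/

section Forward

variable {θ θ' : ArbitraryElements} {φ : PointTransformation}

theorem pd_eu_ex_ex {S : Set (ℝ × ℝ × ℝ)} {F : ℝ × ℝ × ℝ → ℝ} (hS : IsOpen S)
    (hF : ContDiffOn ℝ ∞ F S) {p : ℝ × ℝ × ℝ} (hp : p ∈ S) :
    pd eu (pd ex (pd ex F)) p = pd ex (pd ex (pd eu F)) p :=
  (pd_comm hS (contDiffOn_pd hS hF ex) hp eu ex).trans
    (pd_congr hS (fun _ hq => pd_comm hS hF hq eu ex) hp ex)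

/-- Consequences of the determining equations: `U_u = X_x / T_t` depends on `t` only,
`U_x = -U_tu`, and the two remaining equations. -/
theorem solved_determining_equations (hθ : θ.InClass φ.dom) (hθ' : θ'.InClass φ.ran)
    (hpres : ∀ z w : Jet, φ.Prolongs z w → z ∈ θ.equation → w ∈ θ'.equation) {T : ℝ → ℝ}
    (hT : ∀ t x u : ℝ, (t, x, u) ∈ φ.dom → φ.tComp (t, x, u) = T t)
    {t x u : ℝ} (hp : (t, x, u) ∈ φ.dom) :
    pd ex φ.xComp (t, x, u) = deriv T t * pd eu φ.uComp (t, x, u) ∧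
    pd ex (pd eu φ.uComp) (t, x, u) = 0 ∧
    pd ex φ.uComp (t, x, u) = -pd et (pd eu φ.uComp) (t, x, u) ∧
    pd et φ.uComp (t, x, u) = pd ex φ.uComp (t, x, u) * (θ.A11 t * x + θ.A10 t - u) ∧
    pd ex φ.xComp (t, x, u) * (θ.A11 t * x + θ.A10 t - u) - pd et φ.xComp (t, x, u)
      + deriv T t * φ.uComp (t, x, u) =
      deriv T t * (θ'.A11 (T t) * φ.xComp (t, x, u) + θ'.A10 (T t)) := by
  have hdom := φ.isOpen_dom
  have hsX := φ.smooth_xComp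
  have hsU := φ.smooth_uComp
  have hsXt := contDiffOn_pd hdom hsX et
  have hsXx := contDiffOn_pd hdom hsX ex
  have hsXxx := contDiffOn_pd hdom hsXx ex
  have hsUt := contDiffOn_pd hdom hsU et
  have hsUx := contDiffOn_pd hdom hsU ex
  have hsUxx := contDiffOn_pd hdom hsUx ex
  have hsV := contDiffOn_pd hdom hsU eu
  have hsVt := contDiffOn_pd hdom hsV et
  have hsVx := contDiffOn_pd hdom hsV ex
  have hsVxx := contDiffOn_pd hdom hsVx ex
  have lineU : ∀ {F : ℝ × ℝ × ℝ → ℝ}, ContDiffOn ℝ ∞ F φ.dom → ∀ {t x u : ℝ},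
      (t, x, u) ∈ φ.dom → HasDerivAt (fun s => F (t, x, s)) (pd eu F (t, x, u)) u :=
    fun hF _ _ _ hp => hasDerivAt_u (differentiableAt_of_smooth hdom hF hp)
  have hTt : ∀ t x u : ℝ, (t, x, u) ∈ φ.dom → pd et φ.tComp (t, x, u) = deriv T t :=
    fun t x u hp => (hasDerivAt_function_of_t hdom φ.smooth_tComp hT hp).deriv.symm
  have hXu : ∀ p ∈ φ.dom, pd eu φ.xComp p = 0 := fun p hp =>
    (xComp_conditions hθ hθ' hpres hp).1
  have hXx0 : ∀ p ∈ φ.dom, pd ex φ.xComp p ≠ 0 := fun p hp =>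
    (xComp_conditions hθ hθ' hpres hp).2.2.1
  have hV0 : ∀ p ∈ φ.dom, pd eu φ.uComp p ≠ 0 := fun p hp =>
    (xComp_conditions hθ hθ' hpres hp).2.2.2.1
  have hVu : ∀ p ∈ φ.dom, pd eu (pd eu φ.uComp) p = 0 := fun p hp =>
    (determining_equations hθ hθ' hpres hp).1
  have hXtu : ∀ p ∈ φ.dom, pd eu (pd et φ.xComp) p = 0 := fun p hp => by
    rw [pd_comm hdom hsX hp, pd_eq_zero_of_eq_zero hdom hXu hp]
  have hXxu : ∀ p ∈ φ.dom, pd eu (pd ex φ.xComp) p = 0 := fun p hp => by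
    rw [pd_comm hdom hsX hp, pd_eq_zero_of_eq_zero hdom hXu hp]
  have hXxxu : ∀ p ∈ φ.dom, pd eu (pd ex (pd ex φ.xComp)) p = 0 := fun p hp => by
    rw [pd_comm hdom hsXx hp, pd_eq_zero_of_eq_zero hdom hXxu hp]
  have hVtu : ∀ p ∈ φ.dom, pd eu (pd et (pd eu φ.uComp)) p = 0 := fun p hp => by
    rw [pd_comm hdom hsV hp, pd_eq_zero_of_eq_zero hdom hVu hp]
  have hVxu : ∀ p ∈ φ.dom, pd eu (pd ex (pd eu φ.uComp)) p = 0 := fun p hp => by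
    rw [pd_comm hdom hsV hp, pd_eq_zero_of_eq_zero hdom hVu hp]
  have hVxxu : ∀ p ∈ φ.dom, pd eu (pd ex (pd ex (pd eu φ.uComp))) p = 0 := fun p hp => by
    rw [pd_comm hdom hsVx hp, pd_eq_zero_of_eq_zero hdom hVxu hp]
  -- Below, V = U_u. Only -X_x u and T_t U depend on u inside the bracket of the second determining
  -- equation, so its u-derivative is V (T_t V - X_x) = 0.
  have hXxV : ∀ t x u : ℝ, (t, x, u) ∈ φ.dom →
      pd ex φ.xComp (t, x, u) = deriv T t * pd eu φ.uComp (t, x, u) := by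
    intro t x u hp
    have h1 := (lineU hsV hp).mul ((((((lineU hsXx hp).mul
      ((hasDerivAt_id u).const_sub (θ.A11 t * x + θ.A10 t))).sub (lineU hsXt hp)).add
      ((lineU hsU hp).const_mul (deriv T t))).add
      ((lineU hsXxx hp).const_mul (θ.A2 (t, x)))).sub
      ((((lineU hsX hp).const_mul (θ'.A11 (T t))).add_const (θ'.A10 (T t))).const_mul (deriv T t)))
    have h2 := ((lineU hsXx hp).const_mul (2 * θ.A2 (t, x))).mul (lineU hsVx hp)
    have h3 := h1.unique (h2.congr_of_eventuallyEq ?_)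
    · rw [hVu _ hp, hXxu _ hp, hXtu _ hp, hXxxu _ hp, hXu _ hp, hVxu _ hp] at h3
      have h4 : pd eu φ.uComp (t, x, u) *
          (deriv T t * pd eu φ.uComp (t, x, u) - pd ex φ.xComp (t, x, u)) = 0 := by
        linear_combination h3
      linarith [(mul_eq_zero.mp h4).resolve_left (hV0 _ hp)]
    · filter_upwards [eventually_mem_u hdom hp] with s hs
      have := (determining_equations hθ hθ' hpres hs).2.1
      rw [hTt _ _ _ hs, hT _ _ _ hs] at this
      exact this
  have hXxxV : ∀ t x u : ℝ, (t, x, u) ∈ φ.dom →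
      pd ex (pd ex φ.xComp) (t, x, u) = deriv T t * pd ex (pd eu φ.uComp) (t, x, u) := by
    intro t x u hp
    exact pd_ex_eq hdom hsXx hp (fun s hs => hXxV t s u hs)
      ((hasDerivAt_x (differentiableAt_of_smooth hdom hsV hp)).const_mul _)
  have hL : ∀ t x u : ℝ, (t, x, u) ∈ φ.dom →
      pd ex φ.xComp (t, x, u) * (θ.A11 t * x + θ.A10 t - u) - pd et φ.xComp (t, x, u)
      + deriv T t * φ.uComp (t, x, u)
      - deriv T t * (θ'.A11 (T t) * φ.xComp (t, x, u) + θ'.A10 (T t))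
      = θ.A2 (t, x) * pd ex (pd ex φ.xComp) (t, x, u) := by
    intro t x u hp
    have h := (determining_equations hθ hθ' hpres hp).2.1
    rw [hTt _ _ _ hp, hT _ _ _ hp] at h
    refine mul_left_cancel₀ (hV0 _ hp) ?_
    linear_combination h
      + 2 * θ.A2 (t, x) * pd ex (pd eu φ.uComp) (t, x, u) * hXxV _ _ _ hp
      - 2 * θ.A2 (t, x) * pd eu φ.uComp (t, x, u) * hXxxV _ _ _ hp
  -- The third determining equation with `hL` substituted, which removes Ã¹¹, Ã¹⁰ and the
  -- undifferentiated U. The relation `hC2` is its u-derivative.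
  have hC : ∀ t x u : ℝ, (t, x, u) ∈ φ.dom →
      pd ex φ.xComp (t, x, u) * pd et φ.uComp (t, x, u) + pd ex φ.uComp (t, x, u) *
        (2 * θ.A2 (t, x) * pd ex (pd ex φ.xComp) (t, x, u)
          - pd ex φ.xComp (t, x, u) * (θ.A11 t * x + θ.A10 t - u)) =
      θ.A2 (t, x) * pd ex φ.xComp (t, x, u) * pd ex (pd ex φ.uComp) (t, x, u) := by
    intro t x u hp
    have h := (determining_equations hθ hθ' hpres hp).2.2
    rw [hTt _ _ _ hp, hT _ _ _ hp] at h
    linear_combination h - pd ex φ.uComp (t, x, u) * hL _ _ _ hp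
  have hC2 : ∀ t x u : ℝ, (t, x, u) ∈ φ.dom →
      pd ex φ.xComp (t, x, u) * pd et (pd eu φ.uComp) (t, x, u)
        + pd ex (pd eu φ.uComp) (t, x, u) *
        (2 * θ.A2 (t, x) * pd ex (pd ex φ.xComp) (t, x, u)
          - pd ex φ.xComp (t, x, u) * (θ.A11 t * x + θ.A10 t - u))
        + pd ex φ.uComp (t, x, u) * pd ex φ.xComp (t, x, u) =
      θ.A2 (t, x) * pd ex φ.xComp (t, x, u) * pd ex (pd ex (pd eu φ.uComp)) (t, x, u) := by
    intro t x u hp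
    have h1 := ((lineU hsXx hp).mul (lineU hsUt hp)).add ((lineU hsUx hp).mul
      (((lineU hsXxx hp).const_mul (2 * θ.A2 (t, x))).sub ((lineU hsXx hp).mul
      ((hasDerivAt_id u).const_sub (θ.A11 t * x + θ.A10 t)))))
    have h2 := ((lineU hsXx hp).const_mul (θ.A2 (t, x))).mul (lineU hsUxx hp)
    have h3 := h1.unique (h2.congr_of_eventuallyEq ?_)
    · rw [hXxu _ hp, hXxxu _ hp, pd_eu_ex_ex hdom hsU hp, pd_comm hdom hsU hp eu et,
        pd_comm hdom hsU hp eu ex] at h3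
      simp only [Pi.sub_apply, Pi.mul_apply, id] at h3
      linear_combination h3
    · filter_upwards [eventually_mem_u hdom hp] with s hs
      exact hC _ _ _ hs
  -- The second u-derivative of `hC` leaves just 2 X_x V_x = 0: one V_x comes from differentiating
  -- -u in the bracket, the other from U_xu.
  have hVx : ∀ p ∈ φ.dom, pd ex (pd eu φ.uComp) p = 0 := by
    rintro ⟨t, x, u⟩ hp
    have h1 := (((lineU hsXx hp).mul (lineU hsVt hp)).add ((lineU hsVx hp).mul
      (((lineU hsXxx hp).const_mul (2 * θ.A2 (t, x))).sub ((lineU hsXx hp).mul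
      ((hasDerivAt_id u).const_sub (θ.A11 t * x + θ.A10 t)))))).add
      ((lineU hsUx hp).mul (lineU hsXx hp))
    have h2 := ((lineU hsXx hp).const_mul (θ.A2 (t, x))).mul (lineU hsVxx hp)
    have h3 := h1.unique (h2.congr_of_eventuallyEq ?_)
    · rw [hXxu _ hp, hXxxu _ hp, hVtu _ hp, hVxu _ hp, hVxxu _ hp,
        pd_comm hdom hsU hp eu ex] at h3
      have h4 : pd ex φ.xComp (t, x, u) * pd ex (pd eu φ.uComp) (t, x, u) = 0 := by
        linear_combination h3 / 2
      exact (mul_eq_zero.mp h4).resolve_left (hXx0 _ hp)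
    · filter_upwards [eventually_mem_u hdom hp] with s hs
      exact hC2 _ _ _ hs
  have hXxx : ∀ t x u : ℝ, (t, x, u) ∈ φ.dom → pd ex (pd ex φ.xComp) (t, x, u) = 0 :=
    fun t x u hp => by rw [hXxxV _ _ _ hp, hVx _ hp, mul_zero]
  have hUx : ∀ p ∈ φ.dom, pd ex φ.uComp p = -pd et (pd eu φ.uComp) p := by
    rintro ⟨t, x, u⟩ hp
    have h := hC2 _ _ _ hp
    rw [hVx _ hp, pd_eq_zero_of_eq_zero hdom hVx hp] at h
    refine mul_left_cancel₀ (hXx0 _ hp) ?_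
    linear_combination h
  have hUxx : pd ex (pd ex φ.uComp) (t, x, u) = 0 := by
    have h2 := pd_ex_eq (g := fun s => -pd et (pd eu φ.uComp) (t, s, u)) hdom hsUx hp
      (fun s hs => hUx _ hs) (hasDerivAt_x (differentiableAt_of_smooth hdom hsVt hp)).neg
    rw [h2, pd_comm hdom hsV hp, pd_eq_zero_of_eq_zero hdom hVx hp, neg_zero]
  refine ⟨hXxV _ _ _ hp, hVx _ hp, hUx _ hp, ?_, ?_⟩
  · have h := hC _ _ _ hp
    rw [hXxx _ _ _ hp, hUxx] at h
    refine mul_left_cancel₀ (hXx0 _ hp) ?_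
    linear_combination h
  · have h := hL _ _ _ hp
    rw [hXxx _ _ _ hp] at h
    linear_combination h

/-- T and U_u depend on t only. So do X - X_x x and U - U_u u + U_tu x, and these serve as X⁰ and
U⁰⁰. -/
theorem exists_hasForm (hθ : θ.InClass φ.dom) (hθ' : θ'.InClass φ.ran)
    (hpres : ∀ z w : Jet, φ.Prolongs z w → z ∈ θ.equation → w ∈ θ'.equation) :
    ∃ T X0 U1 U00 : ℝ → ℝ, HasForm φ T X0 U1 U00 := by
  have hdom := φ.isOpen_dom
  have hc := φ.section_connected
  have hsX := φ.smooth_xComp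
  have hsU := φ.smooth_uComp
  have hsXx := contDiffOn_pd hdom hsX ex
  have hsV := contDiffOn_pd hdom hsU eu
  have hsVt := contDiffOn_pd hdom hsV et
  obtain ⟨T, hsT, hT⟩ := exists_function_of_t hdom hc φ.smooth_tComp
    (fun p hp => (pd_tComp_eq_zero hθ hθ' hpres hp).1)
    (fun p hp => (pd_tComp_eq_zero hθ hθ' hpres hp).2)
  have hVu : ∀ p ∈ φ.dom, pd eu (pd eu φ.uComp) p = 0 := fun p hp =>
    (determining_equations hθ hθ' hpres hp).1
  have hVx : ∀ p ∈ φ.dom, pd ex (pd eu φ.uComp) p = 0 := fun p hp =>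
    (solved_determining_equations hθ hθ' hpres hT hp).2.1
  obtain ⟨U1, hsU1, hU1⟩ := exists_function_of_t hdom hc hsV hVx hVu
  have hVt : ∀ t x u : ℝ, (t, x, u) ∈ φ.dom → pd et (pd eu φ.uComp) (t, x, u) = deriv U1 t :=
    fun t x u hp => (hasDerivAt_function_of_t hdom hsV hU1 hp).deriv.symm
  have hXx : ∀ t x u : ℝ, (t, x, u) ∈ φ.dom → pd ex φ.xComp (t, x, u) = deriv T t * U1 t :=
    fun t x u hp => by
      rw [(solved_determining_equations hθ hθ' hpres hT hp).1, hU1 _ _ _ hp]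
  have hUx : ∀ t x u : ℝ, (t, x, u) ∈ φ.dom → pd ex φ.uComp (t, x, u) = -deriv U1 t :=
    fun t x u hp => by
      rw [(solved_determining_equations hθ hθ' hpres hT hp).2.2.1, hVt _ _ _ hp]
  have hcx : ContDiffOn ℝ ∞ (fun p : ℝ × ℝ × ℝ => p.2.1) φ.dom := by fun_prop
  have hcu : ContDiffOn ℝ ∞ (fun p : ℝ × ℝ × ℝ => p.2.2) φ.dom := by fun_prop
  have hsX0 : ContDiffOn ℝ ∞ (fun p => φ.xComp p - pd ex φ.xComp p * p.2.1) φ.dom :=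
    hsX.sub (hsXx.mul hcx)
  obtain ⟨X0, hsX0', hX0⟩ := exists_function_of_t hdom hc hsX0
    (by
      rintro ⟨t, x, u⟩ hp
      have h := (hasDerivAt_x (differentiableAt_of_smooth hdom hsX hp)).sub
        ((hasDerivAt_id x).const_mul (deriv T t * U1 t))
      refine (pd_ex_eq hdom hsX0 hp (fun s hs => ?_) h).trans ?_
      · simp [hXx _ _ _ hs]
      · simp [hXx _ _ _ hp])
    (by
      rintro ⟨t, x, u⟩ hp
      have h := (hasDerivAt_u (differentiableAt_of_smooth hdom hsX hp)).sub_const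
        (deriv T t * U1 t * x)
      refine (pd_eu_eq hdom hsX0 hp (fun s hs => ?_) h).trans
        (xComp_conditions hθ hθ' hpres hp).1
      simp [hXx _ _ _ hs])
  have hsU00 : ContDiffOn ℝ ∞ (fun p => φ.uComp p - pd eu φ.uComp p * p.2.2
      + pd et (pd eu φ.uComp) p * p.2.1) φ.dom :=
    (hsU.sub (hsV.mul hcu)).add (hsVt.mul hcx)
  obtain ⟨U00, hsU00', hU00⟩ := exists_function_of_t hdom hc hsU00
    (by
      rintro ⟨t, x, u⟩ hp
      have h := ((hasDerivAt_x (differentiableAt_of_smooth hdom hsU hp)).sub_const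
        (U1 t * u)).add ((hasDerivAt_id x).const_mul (deriv U1 t))
      refine (pd_ex_eq hdom hsU00 hp (fun s hs => ?_) h).trans ?_
      · simp [hU1 _ _ _ hs, hVt _ _ _ hs]
      · simp [hUx _ _ _ hp])
    (by
      rintro ⟨t, x, u⟩ hp
      have h := ((hasDerivAt_u (differentiableAt_of_smooth hdom hsU hp)).sub
        ((hasDerivAt_id u).const_mul (U1 t))).add_const (deriv U1 t * x)
      refine (pd_eu_eq hdom hsU00 hp (fun s hs => ?_) h).trans ?_
      · simp [hU1 _ _ _ hs, hVt _ _ _ hs]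
      · simp [hU1 _ _ _ hp])
  refine ⟨T, X0, U1, U00, hsT, hsX0', hsU1, hsU00', hT, fun t x u hp => ?_, fun t x u hp => ?_⟩
  · rw [← hX0 _ _ _ hp, hXx _ _ _ hp]
    ring
  · rw [← hU00 _ _ _ hp, hU1 _ _ _ hp, hVt _ _ _ hp]
    ring

/-- For φ of this form, u cancels from the last two equations of `solved_determining_equations`,
which become affine in x; each splits into two relations because x varies over an open set. -/
theorem relations_of_hasForm (hθ : θ.InClass φ.dom) (hθ' : θ'.InClass φ.ran)
    (hpres : ∀ z w : Jet, φ.Prolongs z w → z ∈ θ.equation → w ∈ θ'.equation)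
    {T X0 U1 U00 : ℝ → ℝ} (h : HasForm φ T X0 U1 U00) {t x u : ℝ} (hp : (t, x, u) ∈ φ.dom) :
    deriv T t * U1 t ≠ 0 ∧
    deriv (deriv U1) t = θ.A11 t * deriv U1 t ∧
    deriv U00 t = -(θ.A10 t * deriv U1 t) ∧
    θ'.A2 (T t, deriv T t * U1 t * x + X0 t) = U1 t ^ 2 * deriv T t * θ.A2 (t, x) ∧
    θ'.A11 (T t) =
      1 / deriv T t * (θ.A11 t - deriv (deriv T) t / deriv T t - 2 * deriv U1 t / U1 t) ∧
    θ'.A10 (T t) =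
      U1 t * θ.A10 t - deriv X0 t / deriv T t + U00 t
        - X0 t / deriv T t *
          (θ.A11 t - deriv (deriv T) t / deriv T t - 2 * deriv U1 t / U1 t) := by
  have hdom := φ.isOpen_dom
  obtain ⟨-, hT0, hXx0, hU0, hA2⟩ := xComp_conditions hθ hθ' hpres hp
  rw [h.pd_et_tComp hp] at hT0 hA2
  rw [h.pd_ex_xComp _ _ _ hp] at hXx0 hA2
  rw [h.pd_eu_uComp _ _ _ hp] at hU0
  rw [h.tComp_eq _ _ _ hp, h.xComp_eq _ _ _ hp] at hA2
  have hC : deriv (deriv U1) t - θ.A11 t * deriv U1 t = 0 ∧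
      -(deriv U00 t + θ.A10 t * deriv U1 t) = 0 := by
    refine eq_zero_of_affine_on_section hdom hp fun y hy => ?_
    have := (solved_determining_equations hθ hθ' hpres h.tComp_eq hy).2.2.2.1
    rw [h.pd_et_uComp hy, h.pd_ex_uComp _ _ _ hy] at this
    linear_combination -this
  have hL : (deriv T t * U1 t * θ.A11 t - (deriv (deriv T) t * U1 t + deriv T t * deriv U1 t)
        - deriv T t * deriv U1 t - deriv T t * (θ'.A11 (T t) * (deriv T t * U1 t))) = 0 ∧
      deriv T t * U1 t * θ.A10 t - deriv X0 t + deriv T t * U00 t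
        - deriv T t * (θ'.A11 (T t) * X0 t + θ'.A10 (T t)) = 0 := by
    refine eq_zero_of_affine_on_section hdom hp fun y hy => ?_
    have := (solved_determining_equations hθ hθ' hpres h.tComp_eq hy).2.2.2.2
    rw [h.pd_ex_xComp _ _ _ hy, h.pd_et_xComp hy, h.xComp_eq _ _ _ hy, h.uComp_eq _ _ _ hy] at this
    linear_combination this
  obtain ⟨hL1, hL2⟩ := hL
  have h11 : θ'.A11 (T t) =
      1 / deriv T t * (θ.A11 t - deriv (deriv T) t / deriv T t - 2 * deriv U1 t / U1 t) := by
    field_simp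
    linear_combination -hL1
  refine ⟨hXx0, by linarith [hC.1], by linarith [hC.2], ?_, h11, ?_⟩
  · refine mul_left_cancel₀ hT0 ?_
    linear_combination -hA2
  · have h10 : θ'.A10 (T t) = U1 t * θ.A10 t - deriv X0 t / deriv T t + U00 t
        - θ'.A11 (T t) * X0 t := by
      field_simp
      linear_combination -hL2
    rw [h10, h11]
    ring

end Forward

end BurgersL0

theorem mainTheorem10 (θ : BurgersL0.ArbitraryElements) (φ : BurgersL0.PointTransformation)
    (θ' : BurgersL0.ArbitraryElements) :
    (θ, φ, θ') ∈ BurgersL0.equivalenceGroupoid ↔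
      θ.InClass φ.dom ∧ θ'.InClass φ.ran ∧
      ∃ T X0 U1 U00 : ℝ → ℝ,
        ContDiffOn ℝ ∞ T (BurgersL0.projT φ.dom) ∧
        ContDiffOn ℝ ∞ X0 (BurgersL0.projT φ.dom) ∧
        ContDiffOn ℝ ∞ U1 (BurgersL0.projT φ.dom) ∧
        ContDiffOn ℝ ∞ U00 (BurgersL0.projT φ.dom) ∧
        (∀ t ∈ BurgersL0.projT φ.dom, deriv T t * U1 t ≠ 0) ∧
        -- the components of the point transformation
        (∀ t x u : ℝ, (t, x, u) ∈ φ.dom →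
          φ.tComp (t, x, u) = T t ∧
          φ.xComp (t, x, u) = deriv T t * U1 t * x + X0 t ∧
          φ.uComp (t, x, u) = U1 t * u - deriv U1 t * x + U00 t) ∧
        -- the classifying conditions
        (∀ t ∈ BurgersL0.projT φ.dom,
          deriv (deriv U1) t = θ.A11 t * deriv U1 t ∧
          deriv U00 t = -(θ.A10 t * deriv U1 t)) ∧
        -- the relation between the arbitrary elements
        (∀ t x : ℝ, (t, x) ∈ BurgersL0.projTX φ.dom →
          θ'.A2 (T t, deriv T t * U1 t * x + X0 t) = U1 t ^ 2 * deriv T t * θ.A2 (t, x)) ∧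
        (∀ t ∈ BurgersL0.projT φ.dom,
          θ'.A11 (T t) =
            1 / deriv T t * (θ.A11 t - deriv (deriv T) t / deriv T t - 2 * deriv U1 t / U1 t) ∧
          θ'.A10 (T t) =
            U1 t * θ.A10 t - deriv X0 t / deriv T t + U00 t
              - X0 t / deriv T t *
                (θ.A11 t - deriv (deriv T) t / deriv T t - 2 * deriv U1 t / U1 t)) := by
  open BurgersL0 in
  constructor
  · rintro ⟨hθ, hθ', heq⟩
    -- One implication of the equivalence suffices for necessity.
    have hpres : ∀ z w : Jet, φ.Prolongs z w → z ∈ θ.equation → w ∈ θ'.equation :=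
      fun z w hzw => (heq z w hzw).mp
    obtain ⟨T, X0, U1, U00, h⟩ := exists_hasForm hθ hθ' hpres
    refine ⟨hθ, hθ', T, X0, U1, U00, h.smoothT, h.smoothX0, h.smoothU1, h.smoothU00, ?_,
      fun t x u hp => ⟨h.tComp_eq t x u hp, h.xComp_eq t x u hp, h.uComp_eq t x u hp⟩, ?_, ?_, ?_⟩
    · rintro _ ⟨⟨t, x, u⟩, hp, rfl⟩
      exact (relations_of_hasForm hθ hθ' hpres h hp).1
    · rintro _ ⟨⟨t, x, u⟩, hp, rfl⟩
      obtain ⟨-, h1, h2, -⟩ := relations_of_hasForm hθ hθ' hpres h hp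
      exact ⟨h1, h2⟩
    · rintro t x ⟨⟨t', x', u⟩, hp, he⟩
      obtain ⟨rfl, rfl⟩ := Prod.mk.inj he
      exact (relations_of_hasForm hθ hθ' hpres h hp).2.2.2.1
    · rintro _ ⟨⟨t, x, u⟩, hp, rfl⟩
      exact (relations_of_hasForm hθ hθ' hpres h hp).2.2.2.2
  · rintro ⟨hθ, hθ', T, X0, U1, U00, hT, hX0, hU1, hU00, hne, hform, hcl, hA2, hA1⟩
    have h : HasForm φ T X0 U1 U00 :=
      ⟨hT, hX0, hU1, hU00, fun t x u hp => (hform t x u hp).1,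
        fun t x u hp => (hform t x u hp).2.1, fun t x u hp => (hform t x u hp).2.2⟩
    exact ⟨hθ, hθ', fun z w hzw => mem_equation_iff h hne hcl hA2 hA1 hzw⟩
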